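/- Hyperlogarithms. For a word $w=\sigma_1\cdots\sigma_n$ of complex letters put $L_{0^n}(z)=\frac{\log^n z}{n!}$ (so $L_1=1$ for the empty word) and otherwise $L_{\sigma w'}(z)=\int_0^z \frac{L_{w'}(z')}{z'-\sigma}\,dz'$, integrated along the straight segment, with $\log$ the principal branch. If $f(z)=\sum_{i=0}^n f_i(z)\log^i z$ for large $z\in(0,\infty)$ with all $f_i(1/z)$ holomorphic at $z=0$, put $\operatorname{Reg}_{z\to\infty}f(z)=f_0(\infty)$; if $F(t)=\sum_{i=0}^n F_i(t)\log^i t$ near $t=0$ with all $F_i$ holomorphic at $0$, put $\operatorname{Reg}_{t\to 0}F(t)=F_0(0)$. Let $\Sigma\subset\mathbb{Q}(t)$ be a finite set of rational functions that contains $0$ and contains no positive constant, let $T(\Sigma)$ be the $\mathbb{Q}$-vector space spanned by the words over $\Sigma$, and extend $w\mapsto L_w(z)$ linearly to $T(\Sigma)$. Let $\Sigma_t\subset\mathbb{C}$ be the set of all zeros and poles of the differences $\sigma-\rho$ of distinct $\sigma,\rho\in\Sigma$. Let $U$ be the plane cut along $(-\infty,0]$ and along the rays $\{r\tau: r\ge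 1\}$, $\tau\in\Sigma_t$, and let $D$ be the set of all $t\in U$ such that $\sigma(t)\notin(0,\infty)$ for all $\sigma\in\Sigma$. Then $\Sigma_t$ is a finite set of algebraic numbers, $D$ is open and dense in $\mathbb{C}$, and for all $w\in T(\Sigma)$ and $t\in D$ the regularized limit $R_w(t):=\operatorname{Reg}_{z\to\infty}L_w(z)$, the letters being evaluated at $t$, exists and is unique. Moreover, let $V\subseteq D$ be open, connected and non-empty. For every $w\in T(\Sigma)$, $R_w|_V$ has an analytic continuation to $U$ that has a regularized limit at $t\to0$ in $U$; write $\operatorname{Reg}_{t\to 0}R_w$ for this (uniquely determined) number, which may depend on $V$. And $R_w$ is on $V$ a hyperlogarithm in $t$ over the alphabet $\Sigma_t$ whose coefficients are such regularized limits: there is a finite sum $$R_w(t)=\sum_{u} c_u\,L_u(t)\qquad(t\in V)$$ over words $u$ in the letters $\Sigma_t$ in which every $c_u$ is of the form $c_u=\operatorname{Reg}_{t\to 0}R_v$ for some $v\in T(\Sigma)$. -/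

import Mathlib

open Filter Topology

noncomputable section

/-- The `ℚ`-vector space `T(A)` spanned by the words over the alphabet `A`. -/
abbrev WordSpace (A : Type*) : Type _ := List A →₀ ℚ

open Classical in
/-- The hyperlogarithm `L_w(z)` of a word `w` of complex letters, integrated along the straight
segment from `0` to `z` and with the principal logarithm: `L_{0^n}(z) = log(z)^n / n!`, and
otherwise `L_{σ w}(z) = ∫_0^z L_w(z') dz' / (z' - σ)`, where `z' = s z` with `0 < s < 1`. -/
def hyperlog : List ℂ → ℂ → ℂ
  | [], _ => 1
  | σ :: w, z =>
      if ∀ x ∈ σ :: w, x = 0 then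
        Complex.log z ^ (w.length + 1) / ((w.length + 1).factorial : ℂ)
      else
        ∫ s in (0 : ℝ)..1, z / ((s : ℂ) * z - σ) * hyperlog w ((s : ℂ) * z)

/-- The value `σ(t)` of a rational function `σ ∈ ℚ(t)` at a complex number `t`
(used only where `t` is not a pole of `σ`). -/
def letterAt (σ : RatFunc ℚ) (t : ℂ) : ℂ := RatFunc.eval (algebraMap ℚ ℂ) t σ

/-- `L_w(z)` for `w ∈ T(A)`, the letters in `A ⊆ ℚ(t)` being evaluated at `t`,
extended linearly from words to `T(A)`. -/
def hyperlogAt {A : Finset (RatFunc ℚ)} (w : WordSpace A) (t z : ℂ) : ℂ :=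
  w.sum fun v q => (q : ℂ) * hyperlog (v.map fun σ => letterAt σ.1 t) z

/-- `c` is the regularized limit of `f` at `z → ∞` along `(0, ∞)`: near infinity
`f(z) = ∑_{i ≤ n} f_i(z) log(z)^i` with all `f_i(1/z)` holomorphic at `z = 0`,
and `c = f_0(∞)`. Here `g i` stands for `f_i(1/z)`. -/
def HasRegLimInf (f : ℂ → ℂ) (c : ℂ) : Prop :=
  ∃ (n : ℕ) (g : ℕ → ℂ → ℂ), (∀ i, AnalyticAt ℂ (g i) 0) ∧ g 0 0 = c ∧
    ∀ᶠ x : ℝ in atTop,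
      f (x : ℂ) = ∑ i ∈ Finset.range (n + 1), g i ((x : ℂ)⁻¹) * Complex.log (x : ℂ) ^ i

open Classical in
/-- The regularized limit of `f` at `z → ∞` (`0` if there is none). -/
def regLimInf (f : ℂ → ℂ) : ℂ :=
  if h : ∃ c, HasRegLimInf f c then h.choose else 0

/-- `Reg_{z → ∞} L_w(z)` as a function of the parameter `t`. -/
def regHyperlog {A : Finset (RatFunc ℚ)} (w : WordSpace A) (t : ℂ) : ℂ :=
  regLimInf fun z => hyperlogAt w t z

/-- The set `Σ_t` of all zeros and poles in `ℂ` of the differences of distinct letters. -/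
def zeroPoleSet (A : Finset (RatFunc ℚ)) : Set ℂ :=
  {τ | ∃ σ ∈ A, ∃ ρ ∈ A, σ ≠ ρ ∧
    (Polynomial.aeval τ (σ - ρ).num = 0 ∨ Polynomial.aeval τ (σ - ρ).denom = 0)}

/-- The plane cut along `(-∞, 0]` and along the rays `[τ, τ ∞)` for `τ ∈ S`. -/
def cutPlane (S : Set ℂ) : Set ℂ :=
  {t | t ∈ Complex.slitPlane ∧ ∀ τ ∈ S, ∀ r : ℝ, 1 ≤ r → t ≠ (r : ℂ) * τ}

/-- The parameters `t` in the cut plane for which no letter takes a value in `(0, ∞)`. -/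
def paramDomain (A : Finset (RatFunc ℚ)) : Set ℂ :=
  {t | t ∈ cutPlane (zeroPoleSet A) ∧ ∀ σ ∈ A, ∀ x : ℝ, 0 < x → letterAt σ t ≠ (x : ℂ)}

/-- `c` is the regularized limit at `t → 0` in `U` of the analytic continuation `F` to `U` of the
function `f` on `V ⊆ U`: near `0` one has `F(t) = ∑_{i ≤ n} f_i(t) log(t)^i` with all
`f_i` holomorphic at `0`, and `c = f_0(0)`. -/
def HasRegLimZero (U V : Set ℂ) (f : ℂ → ℂ) (c : ℂ) : Prop :=
  ∃ F : ℂ → ℂ, DifferentiableOn ℂ F U ∧ Set.EqOn F f V ∧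
    ∃ (n : ℕ) (g : ℕ → ℂ → ℂ), (∀ i, AnalyticAt ℂ (g i) 0) ∧ g 0 0 = c ∧
      ∀ᶠ t in 𝓝[U] (0 : ℂ),
        F t = ∑ i ∈ Finset.range (n + 1), g i t * Complex.log t ^ i

end

/-! The heart is a differential equation in the parameter. There are rational combinations of words
∂_τ w (`wordDeriv`), each one letter shorter than w, such that R_w'(t) = ∑_τ (t - τ)⁻¹ R_{∂_τ w}(t).
Their coefficients are the orders at τ of differences of neighbouring letters, the last letter being
compared with 0. So R_w is an iterated primitive: once every R_{∂_τ w} is a combination of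
hyperlogarithms on V, prepending τ integrates it, and a constant remains. Since L_u has regularized
value 0 at t = 0 for nonempty u, that constant, the coefficient of the empty word, is Reg R_w
itself; all other coefficients are inherited from shorter words (`LetterSystem.exists_hyperlogSum`).
The combination is analytic on the whole cut plane, which also gives the continuation of R_w.

The equation is the limit x → ∞ of a formula for ∂_t L_w(x): the analogous sum over τ, minus the
boundary term a_i'(t) (x - a_i(t))⁻¹ L_{w'}(x) when w = i w'
(`LetterSystem.hasDerivAt_letterLog_param`). It is proved in integrated form along a segment in t.
By induction on the length, L_w(x,t) - L_w(x,t₀) and the integral of the claimed derivative have the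
same x-derivative; they also have the same regularized value at x = 0, hence agree. At infinity the
boundary term regularizes to 0 (`LetterSystem.hasDerivAt_letterReg`).

The exchange of regularization and integration over t (`FamLogExp.reg_integral`) is made automatic
by expanding in powers of log x with coefficients analytic into the Banach algebra C(X, ℂ), X being
a closed disc of parameters. These expansions are stable under primitives of z⁻¹ f(z)
(`LogExp.exists_primitive`), and their values at 0 are unique (`LogExp.values_unique`).

The domain D is open because a nonzero letter has no zero in the cut plane, and dense because a
nonconstant letter is an open map and so cannot stay in (0, ∞). -/

/-! ### Logarithmic expansions at 0 with values in a normed space. -/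

section LogExp

variable {E : Type*} [NormedAddCommGroup E] [NormedSpace ℂ E]

/-- `f` is near `0` in the slit plane a polynomial in `log z` with coefficients `g i` analytic
at `0`, and `v i` is the value of the `i`-th coefficient at `0`. -/
def LogExp (f : ℂ → E) (v : ℕ → E) : Prop :=
  ∃ (n : ℕ) (g : ℕ → ℂ → E), (∀ i, AnalyticAt ℂ (g i) 0) ∧ (∀ i, g i 0 = v i) ∧
    (∀ i, n ≤ i → g i = 0) ∧
    ∀ᶠ z in 𝓝[Complex.slitPlane] 0, f z = ∑ i ∈ Finset.range n, Complex.log z ^ i • g i z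

theorem sum_range_eq_of_vanish {M : Type*} [AddCommMonoid M] {n m : ℕ} (hnm : n ≤ m) (h : ℕ → M)
    (hv : ∀ i, n ≤ i → h i = 0) : ∑ i ∈ Finset.range n, h i = ∑ i ∈ Finset.range m, h i := by
  refine Finset.sum_subset (Finset.range_mono hnm) fun i _ hi => hv i ?_
  simpa using hi

theorem LogExp.congr {f f' : ℂ → E} {v : ℕ → E} (h : LogExp f v)
    (hf : ∀ᶠ z in 𝓝[Complex.slitPlane] 0, f' z = f z) : LogExp f' v := by
  obtain ⟨n, g, h1, h2, h3, h4⟩ := h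
  refine ⟨n, g, h1, h2, h3, ?_⟩
  filter_upwards [h4, hf] with z hz hz'
  rw [hz', hz]

theorem logExp_zero : LogExp (fun _ => (0 : E)) 0 :=
  ⟨0, 0, fun _ => analyticAt_const, fun _ => rfl, fun _ _ => rfl, by simp⟩

theorem LogExp.add {f f' : ℂ → E} {v v' : ℕ → E} (h : LogExp f v) (h' : LogExp f' v') :
    LogExp (fun z => f z + f' z) (v + v') := by
  obtain ⟨n, g, h1, h2, h3, h4⟩ := h
  obtain ⟨n', g', h1', h2', h3', h4'⟩ := h'
  refine ⟨max n n', fun i => g i + g' i, fun i => (h1 i).add (h1' i), fun i => by simp [h2, h2'],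
    fun i hi => by simp [h3 i (le_trans (le_max_left _ _) hi),
      h3' i (le_trans (le_max_right _ _) hi)], ?_⟩
  filter_upwards [h4, h4'] with z hz hz'
  rw [hz, hz', sum_range_eq_of_vanish (le_max_left n n') _ fun i hi => by simp [h3 i hi],
    sum_range_eq_of_vanish (le_max_right n n') _ fun i hi => by simp [h3' i hi],
    ← Finset.sum_add_distrib]
  simp

theorem LogExp.map {F : Type*} [NormedAddCommGroup F] [NormedSpace ℂ F] (φ : E →L[ℂ] F)
    {f : ℂ → E} {v : ℕ → E} (h : LogExp f v) : LogExp (fun z => φ (f z)) (fun i => φ (v i)) := by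
  obtain ⟨n, g, h1, h2, h3, h4⟩ := h
  refine ⟨n, fun i z => φ (g i z), fun i => (φ.analyticAt _).comp (h1 i),
    fun i => by simp [h2],
    fun i hi => by funext z; simp [h3 i hi], ?_⟩
  filter_upwards [h4] with z hz
  simp [hz]

theorem LogExp.const_smul {f : ℂ → E} {v : ℕ → E} (c : ℂ) (h : LogExp f v) :
    LogExp (fun z => c • f z) (c • v) :=
  h.map (c • ContinuousLinearMap.id ℂ E)

theorem LogExp.neg {f : ℂ → E} {v : ℕ → E} (h : LogExp f v) :
    LogExp (fun z => - f z) (-v) :=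
  h.map (-ContinuousLinearMap.id ℂ E)

theorem LogExp.sub {f f' : ℂ → E} {v v' : ℕ → E} (h : LogExp f v) (h' : LogExp f' v') :
    LogExp (fun z => f z - f' z) (v - v') := by
  simpa only [sub_eq_add_neg] using h.add h'.neg

theorem LogExp.sum {ι : Type*} {f : ι → ℂ → E} {v : ι → ℕ → E} (s : Finset ι)
    (h : ∀ i ∈ s, LogExp (f i) (v i)) :
    LogExp (fun z => ∑ i ∈ s, f i z) (∑ i ∈ s, v i) := by
  classical
  induction s using Finset.induction_on with
  | empty => simpa using logExp_zero
  | insert a s ha ih =>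
    simp only [Finset.sum_insert ha]
    exact (h a (by simp)).add (ih fun i hi => h i (by simp [hi]))

theorem logExp_log_pow_smul {g : ℂ → E} (hg : AnalyticAt ℂ g 0) (k : ℕ) :
    LogExp (fun z => Complex.log z ^ k • g z) (Pi.single k (g 0)) := by
  refine ⟨k + 1, fun i => if i = k then g else 0, fun i => ?_, fun i => ?_, fun i hi => ?_, ?_⟩
  · dsimp only
    split_ifs
    exacts [hg, analyticAt_const]
  · by_cases h : i = k
    · subst h; simp
    · simp [h]
  · have : i ≠ k := by omega
    simp [this]
  · refine Eventually.of_forall fun z => ?_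
    rw [Finset.sum_eq_single k]
    · simp
    · intro i _ hi
      simp [hi]
    · simp

theorem AnalyticAt.logExp {g : ℂ → E} (hg : AnalyticAt ℂ g 0) :
    LogExp g (Pi.single 0 (g 0)) := by
  simpa using logExp_log_pow_smul hg 0

theorem LogExp.analytic_mul {A : Type*} [NormedRing A] [NormedAlgebra ℂ A] {f k : ℂ → A}
    {v : ℕ → A} (hk : AnalyticAt ℂ k 0) (h : LogExp f v) :
    LogExp (fun z => k z * f z) (fun i => k 0 * v i) := by
  obtain ⟨n, g, h1, h2, h3, h4⟩ := h
  refine ⟨n, fun i z => k z * g i z, fun i => hk.mul (h1 i), fun i => by simp [h2],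
    fun i hi => by funext z; simp [h3 i hi], ?_⟩
  filter_upwards [h4] with z hz
  simp [hz, Finset.mul_sum]

/-- As g vanishes at 0, z⁻¹ g(z) has a removable singularity, filled in by `dslope`; its extension
has a primitive on a disc. -/
theorem exists_analyticAt_primitive [CompleteSpace E] {g : ℂ → E} (hg : AnalyticAt ℂ g 0) (h0 : g 0 = 0) :
    ∃ H : ℂ → E, AnalyticAt ℂ H 0 ∧ H 0 = 0 ∧
      ∀ᶠ z in 𝓝 (0 : ℂ), z ≠ 0 → HasDerivAt H (z⁻¹ • g z) z := by
  have hd : AnalyticAt ℂ (dslope g 0) 0 := by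
    obtain ⟨p, hp⟩ := hg
    exact ⟨_, hp.has_fpower_series_dslope_fslope⟩
  obtain ⟨r, hr, hball⟩ := Metric.eventually_nhds_iff_ball.1 hd.eventually_analyticAt
  obtain ⟨H, hH⟩ := (DifferentiableOn.isExactOn_ball (c := (0 : ℂ)) (r := r)
    fun z hz => (hball z hz).differentiableAt.differentiableWithinAt).with_val_at 0 0
  have hHd : ∀ z ∈ Metric.ball (0 : ℂ) r, HasDerivAt H (dslope g 0 z) z := hH.2
  refine ⟨H, ?_, hH.1, ?_⟩
  · refine DifferentiableOn.analyticAt (s := Metric.ball 0 r) (fun z hz =>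
      (hHd z hz).differentiableAt.differentiableWithinAt) (Metric.ball_mem_nhds _ hr)
  · filter_upwards [Metric.ball_mem_nhds (0 : ℂ) hr] with z hz hz0
    have := hHd z hz
    rw [dslope_of_ne _ hz0, slope_def_module] at this
    simpa [h0] using this

/-- The values at `0` of the coefficients of the regularized primitive of `z⁻¹ • f z`. -/
noncomputable def primitiveValues (v : ℕ → E) : ℕ → E
  | 0 => 0
  | i + 1 => ((i : ℂ) + 1)⁻¹ • v i

theorem eventually_slitPlane_nhds {p : ℂ → Prop} (h : ∀ᶠ z in 𝓝 (0 : ℂ), z ≠ 0 → p z) :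
    ∀ᶠ z in 𝓝[Complex.slitPlane] 0, p z := by
  filter_upwards [nhdsWithin_le_nhds h, self_mem_nhdsWithin] with z hz hz'
  exact hz (Complex.slitPlane_ne_zero hz')

theorem hasDerivAt_log_pow {z : ℂ} (hz : z ∈ Complex.slitPlane) (n : ℕ) :
    HasDerivAt (fun z => Complex.log z ^ n) (z⁻¹ * (n * Complex.log z ^ (n - 1))) z := by
  have := (Complex.hasDerivAt_log hz).pow n
  convert! this using 1
  ring

/-- Integration by parts lowers the power of log z. Choosing the constant of integration to be 0
gives the regularized primitive, whose value at index 0 vanishes. -/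
theorem LogExp.exists_primitive [CompleteSpace E] {f : ℂ → E} {v : ℕ → E} (h : LogExp f v) :
    ∃ F : ℂ → E, LogExp F (primitiveValues v) ∧
      ∀ᶠ z in 𝓝[Complex.slitPlane] 0, HasDerivAt F (z⁻¹ • f z) z := by
  obtain ⟨n, g, h1, h2, h3, h4⟩ := h
  have key : ∃ F : ℂ → E, LogExp F (primitiveValues v) ∧
      ∀ᶠ z in 𝓝[Complex.slitPlane] 0,
        HasDerivAt F (z⁻¹ • ∑ i ∈ Finset.range n, Complex.log z ^ i • g i z) z := by
    clear h4
    induction n generalizing g v with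
    | zero =>
      refine ⟨fun _ => 0, ?_, Eventually.of_forall fun z => by simpa using hasDerivAt_const z 0⟩
      have : primitiveValues v = 0 := by
        funext i
        cases i with
        | zero => rfl
        | succ i => simp [primitiveValues, ← h2, h3]
      rw [this]
      exact logExp_zero
    | succ n ih =>
      obtain ⟨H, hH, hH0, hHd⟩ := exists_analyticAt_primitive
        (g := fun z => g n z - v n) ((h1 n).sub analyticAt_const) (by simp [h2])
      -- Integrating the top term z⁻¹ log^n (g n - v n) by parts leaves -n z⁻¹ log^(n-1) H, which is
      -- absorbed into coefficient n - 1. Since H 0 = 0, the values v i below n are unchanged.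
      set g' : ℕ → ℂ → E := fun i z =>
        if i < n then (if i + 1 = n then g i z - (n : ℂ) • H z else g i z) else 0 with hg'
      obtain ⟨F, hF, hFd⟩ := ih (v := fun i => if i < n then v i else 0) g'
        (fun i => by
          by_cases hi : i < n
          · by_cases hi' : i + 1 = n
            · simp only [hg', hi, hi', if_true]
              exact (h1 i).sub (analyticAt_const.smul hH)
            · simp only [hg', hi, hi', if_true, if_false]
              exact h1 i
          · simp only [hg', hi, if_false]
            exact analyticAt_const)
        (fun i => by simp only [hg', hH0, h2, smul_zero, sub_zero, ite_self])
        (fun i hi => by funext z; simp [hg', not_lt.2 hi])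
      refine ⟨fun z => (F z + Complex.log z ^ n • H z) +
        Complex.log z ^ (n + 1) • (((n : ℂ) + 1)⁻¹ • v n), ?_, ?_⟩
      · have hv : primitiveValues v = (primitiveValues (fun i => if i < n then v i else 0) +
            Pi.single n (H 0)) + Pi.single (n + 1) (((n : ℂ) + 1)⁻¹ • v n) := by
          funext i
          cases i with
          | zero => simp [primitiveValues, hH0]
          | succ i =>
            rcases lt_trichotomy i n with hi | hi | hi
            · simp [primitiveValues, hi, hi.ne, hH0]
            · subst hi
              simp [primitiveValues, hH0]
            · have : v i = 0 := by rw [← h2, h3 i hi]; rfl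
              simp [primitiveValues, hi.ne', hH0, this]
        rw [hv]
        exact (hF.add (logExp_log_pow_smul hH n)).add (logExp_log_pow_smul analyticAt_const (n + 1))
      · filter_upwards [hFd, eventually_slitPlane_nhds hHd, self_mem_nhdsWithin] with z hz1 hz2 hz3
        have hz0 := Complex.slitPlane_ne_zero hz3
        have d1 := (hz1.add ((hasDerivAt_log_pow hz3 n).smul hz2)).add
          ((hasDerivAt_log_pow hz3 (n + 1)).smul (hasDerivAt_const z (((n : ℂ) + 1)⁻¹ • v n)))
        convert! d1 using 1
        have hs : ∑ i ∈ Finset.range n, Complex.log z ^ i • g' i z =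
            ∑ i ∈ Finset.range n, Complex.log z ^ i • g i z -
              (n * Complex.log z ^ (n - 1)) • H z := by
          rcases n with _ | n
          · simp
          · rw [Finset.sum_range_succ, Finset.sum_range_succ]
            have : ∑ i ∈ Finset.range n, Complex.log z ^ i • g' i z =
                ∑ i ∈ Finset.range n, Complex.log z ^ i • g i z := by
              refine Finset.sum_congr rfl fun i hi => ?_
              have hi := Finset.mem_range.1 hi
              simp [hg', hi.ne, not_lt.2 hi.le]
            rw [this]
            simp [hg', smul_sub, smul_smul, mul_comm, add_sub_assoc]
        have hn : ((n : ℂ) + 1) ≠ 0 := Nat.cast_add_one_ne_zero n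
        rw [hs, Finset.sum_range_succ]
        simp only [smul_sub, smul_add, smul_smul, smul_zero, zero_add, Nat.cast_add, Nat.cast_one,
          Nat.add_sub_cancel]
        have : z⁻¹ * (((n : ℂ) + 1) * Complex.log z ^ n) * ((n : ℂ) + 1)⁻¹ =
          z⁻¹ * Complex.log z ^ n := by field_simp
        rw [this, mul_comm (Complex.log z ^ n) z⁻¹]
        module
  obtain ⟨F, hF, hFd⟩ := key
  refine ⟨F, hF, ?_⟩
  filter_upwards [hFd, h4] with z hz hz'
  rwa [hz']

/-- If all values vanish, each coefficient is O(|z|), which beats any power of log z by a factor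
|z|^(1/2). The exponent 1/2 is a convenient choice: it makes z⁻¹ f(z) integrable along rays. -/
theorem LogExp.isBigO {f : ℂ → E} (h : LogExp f 0) :
    f =O[𝓝[Complex.slitPlane] 0] fun z => ‖z‖ ^ (1 / 2 : ℝ) := by
  obtain ⟨n, g, h1, h2, h3, h4⟩ := h
  have hlog : ∀ i : ℕ, (fun z : ℂ => Complex.log z ^ i) =O[𝓝[Complex.slitPlane] 0]
      fun z => ‖z‖ ^ (-(1 / 2) : ℝ) := by
    intro i
    have hnorm : Tendsto (fun z : ℂ => ‖z‖) (𝓝[Complex.slitPlane] 0) (𝓝[>] 0) := by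
      refine tendsto_nhdsWithin_iff.2 ⟨?_, ?_⟩
      · have : Tendsto (fun z : ℂ => ‖z‖) (𝓝 0) (𝓝 ‖(0 : ℂ)‖) := continuous_norm.tendsto 0
        rw [norm_zero] at this
        exact this.mono_left nhdsWithin_le_nhds
      · filter_upwards [self_mem_nhdsWithin] with z hz
        simpa using Complex.slitPlane_ne_zero hz
    have h1 : (fun z : ℂ => Complex.log z) =O[𝓝[Complex.slitPlane] 0]
        fun z => |Real.log ‖z‖| := by
      have hat : ∀ᶠ z : ℂ in 𝓝[Complex.slitPlane] 0, 1 ≤ |Real.log ‖z‖| := by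
        have := (tendsto_abs_atBot_atTop.comp (Real.tendsto_log_nhdsGT_zero.comp hnorm))
        exact this.eventually_ge_atTop 1
      refine Asymptotics.IsBigO.of_bound (1 + Real.pi) ?_
      filter_upwards [hat] with z hz
      have e1 : ‖Complex.log z‖ ≤ |(Complex.log z).re| + |(Complex.log z).im| :=
        Complex.norm_le_abs_re_add_abs_im _
      rw [Complex.log_re, Complex.log_im] at e1
      have e2 := Complex.abs_arg_le_pi z
      rw [Real.norm_eq_abs, abs_abs]
      nlinarith [Real.pi_pos]
    have h2 := (isLittleO_abs_log_rpow_rpow_nhdsGT_zero (s := -(1 / 2)) (i : ℝ)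
      (by norm_num)).comp_tendsto hnorm
    refine (h1.pow i).trans (Asymptotics.IsBigO.trans ?_ h2.isBigO)
    refine Asymptotics.isBigO_of_le _ fun z => ?_
    simp
  have hf : f =ᶠ[𝓝[Complex.slitPlane] 0]
      fun z => ∑ i ∈ Finset.range n, Complex.log z ^ i • g i z := h4
  refine hf.trans_isBigO (Asymptotics.IsBigO.fun_sum fun i _ => ?_)
  have hg : g i =O[𝓝[Complex.slitPlane] 0] fun z => ‖z‖ := by
    have := (h1 i).differentiableAt.isBigO_sub
    simp only [h2, Pi.zero_apply, sub_zero] at this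
    exact (this.mono nhdsWithin_le_nhds).norm_right
  refine ((hlog i).smul hg).congr' EventuallyEq.rfl ?_
  filter_upwards [self_mem_nhdsWithin] with z hz
  have : 0 < ‖z‖ := by simpa using Complex.slitPlane_ne_zero hz
  rw [smul_eq_mul]
  nth_rewrite 2 [← Real.rpow_one ‖z‖]
  rw [← Real.rpow_add this]
  norm_num

theorem LogExp.tendsto_zero {f : ℂ → E} (h : LogExp f 0) :
    Tendsto f (𝓝[Complex.slitPlane] 0) (𝓝 0) := by
  refine h.isBigO.trans_tendsto ?_
  have : Tendsto (fun z : ℂ => ‖z‖ ^ (1 / 2 : ℝ)) (𝓝 0) (𝓝 (‖(0 : ℂ)‖ ^ (1 / 2 : ℝ))) :=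
    (continuous_norm.tendsto 0).rpow_const (Or.inr (by norm_num))
  rw [norm_zero, Real.zero_rpow (by norm_num)] at this
  exact this.mono_left nhdsWithin_le_nhds

theorem tendsto_ofReal_nhdsGT_slitPlane :
    Tendsto (fun x : ℝ => (x : ℂ)) (𝓝[>] 0) (𝓝[Complex.slitPlane] 0) := by
  refine tendsto_nhdsWithin_iff.2 ⟨?_, ?_⟩
  · have : Tendsto (fun x : ℝ => (x : ℂ)) (𝓝 0) (𝓝 ((0 : ℝ) : ℂ)) :=
      Complex.continuous_ofReal.tendsto 0
    exact this.mono_left nhdsWithin_le_nhds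
  · filter_upwards [self_mem_nhdsWithin] with x hx
    exact Complex.ofReal_mem_slitPlane.2 hx

/-- Up to a term tending to 0, f is the polynomial with coefficients v evaluated at log x. A
nonconstant polynomial is unbounded as log x → -∞, so the polynomial is constant with limit 0. -/
theorem LogExp.values_eq_zero {f : ℂ → ℂ} {v : ℕ → ℂ} (h : LogExp f v)
    (hf : ∀ᶠ x : ℝ in 𝓝[>] 0, f x = 0) : v = 0 := by
  obtain ⟨n, g, h1, h2, h3, h4⟩ := h
  set p : Polynomial ℂ := ∑ i ∈ Finset.range n, Polynomial.monomial i (v i) with hp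
  have hcoeff : ∀ i, p.coeff i = v i := by
    intro i
    by_cases hi : i < n
    · simp [hp, Polynomial.coeff_monomial, hi]
    · have : v i = 0 := by rw [← h2, h3 i (not_lt.1 hi)]; rfl
      simp [hp, Polynomial.coeff_monomial, this]
  have hvan : LogExp (fun z => ∑ i ∈ Finset.range n, Complex.log z ^ i • (g i z - v i)) 0 := by
    refine ⟨n, fun i z => g i z - v i, fun i => (h1 i).sub analyticAt_const, fun i => by simp [h2],
      fun i hi => ?_, Eventually.of_forall fun z => rfl⟩
    funext z
    simp [← h2, h3 i hi]
  have htend := hvan.tendsto_zero.comp tendsto_ofReal_nhdsGT_slitPlane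
  have heq : ∀ᶠ x : ℝ in 𝓝[>] 0, p.eval (Complex.log x) =
      -∑ i ∈ Finset.range n, Complex.log x ^ i • (g i x - v i) := by
    filter_upwards [hf, tendsto_ofReal_nhdsGT_slitPlane.eventually h4] with x hx hx'
    rw [hx] at hx'
    simp only [smul_sub, Finset.sum_sub_distrib, ← hx']
    simp [hp, Polynomial.eval_finsetSum, mul_comm]
  have hlim : Tendsto (fun x : ℝ => p.eval (Complex.log x)) (𝓝[>] 0) (𝓝 0) := by
    have := htend.neg
    rw [neg_zero] at this
    exact this.congr' (heq.mono fun x hx => hx.symm)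
  have hdeg : ¬ 0 < p.degree := by
    intro hdeg
    have hlog : Tendsto (fun x : ℝ => ‖Complex.log (x : ℂ)‖) (𝓝[>] 0) atTop := by
      refine (tendsto_abs_atBot_atTop.comp Real.tendsto_log_nhdsGT_zero).congr' ?_
      filter_upwards [self_mem_nhdsWithin] with x hx
      rw [← Complex.ofReal_log (le_of_lt hx), Complex.norm_real]
      rfl
    exact not_tendsto_nhds_of_tendsto_atTop (p.tendsto_norm_atTop hdeg hlog) _ hlim.norm
  have hC := Polynomial.eq_C_of_degree_le_zero (not_lt.1 hdeg)
  rw [hC] at hlim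
  simp only [Polynomial.eval_C] at hlim
  have h0 : p.coeff 0 = 0 := tendsto_nhds_unique tendsto_const_nhds hlim
  funext i
  rw [← hcoeff, hC, h0]
  simp

theorem LogExp.values_unique {f f' : ℂ → ℂ} {v v' : ℕ → ℂ} (h : LogExp f v) (h' : LogExp f' v')
    (hf : ∀ᶠ x : ℝ in 𝓝[>] 0, f x = f' x) : v = v' :=
  sub_eq_zero.1 ((h.sub h').values_eq_zero (hf.mono fun x hx => by simp [hx]))

end LogExp

/-! ### Geometry of the cut plane: star-shaped towards 0, open, and equal to the slit plane near 0.
-/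

section CutPlane

theorem real_mul_mem_slitPlane {z : ℂ} (hz : z ∈ Complex.slitPlane) {s : ℝ} (hs : 0 < s) :
    (s : ℂ) * z ∈ Complex.slitPlane := by
  rw [Complex.mem_slitPlane_iff] at hz ⊢
  rw [Complex.re_ofReal_mul, Complex.im_ofReal_mul]
  rcases hz with h | h
  · exact Or.inl (mul_pos hs h)
  · exact Or.inr (mul_ne_zero hs.ne' h)

theorem real_mul_mem_cutPlane {S : Set ℂ} {z : ℂ} (hz : z ∈ cutPlane S) {s : ℝ} (hs : 0 < s)
    (hs1 : s ≤ 1) : (s : ℂ) * z ∈ cutPlane S := by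
  refine ⟨real_mul_mem_slitPlane hz.1 hs, fun τ hτ r hr h => hz.2 τ hτ (r / s) ?_ ?_⟩
  · rw [le_div_iff₀ hs]
    linarith
  · have : (s : ℂ) ≠ 0 := by exact_mod_cast hs.ne'
    push_cast
    field_simp
    rw [mul_comm]
    exact h

theorem ne_of_mem_cutPlane {S : Set ℂ} {z : ℂ} (hz : z ∈ cutPlane S) {τ : ℂ} (hτ : τ ∈ S) :
    z ≠ τ := by
  simpa using hz.2 τ hτ 1 le_rfl

theorem ne_zero_of_mem_cutPlane {S : Set ℂ} {z : ℂ} (hz : z ∈ cutPlane S) : z ≠ 0 :=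
  Complex.slitPlane_ne_zero hz.1

theorem isOpen_cutPlane {S : Set ℂ} (hS : S.Finite) : IsOpen (cutPlane S) := by
  have : cutPlane S = Complex.slitPlane ∩
      ⋂ τ ∈ S, ((fun r : ℝ => r • τ) '' Set.Ici 1)ᶜ := by
    ext z
    simp only [cutPlane, Set.mem_ofPred_eq, Set.mem_inter_iff, Set.mem_iInter, Set.mem_compl_iff,
      Set.mem_image, Set.mem_Ici, not_exists, not_and, Complex.real_smul]
    exact and_congr_right fun _ => forall₂_congr fun _ _ => forall₂_congr fun _ _ => ne_comm
  rw [this]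
  exact Complex.isOpen_slitPlane.inter (hS.isOpen_biInter fun τ _ =>
    (isClosedMap_smul_left τ _ isClosed_Ici).isOpen_compl)

theorem eventually_mem_cutPlane {S : Set ℂ} (hS : S.Finite) :
    ∀ᶠ z in 𝓝[Complex.slitPlane] 0, z ∈ cutPlane S := by
  have h1 : ∀ᶠ z : ℂ in 𝓝 0, ∀ τ ∈ S, τ ≠ 0 → ‖z‖ < ‖τ‖ := by
    rw [eventually_all_finite hS]
    intro τ _
    by_cases h : τ = 0
    · simp [h]
    · have : Tendsto (fun z : ℂ => ‖z‖) (𝓝 0) (𝓝 0) := by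
        simpa using continuous_norm.tendsto (0 : ℂ)
      filter_upwards [this.eventually_lt_const (norm_pos_iff.2 h)] with z hz _ using hz
  filter_upwards [nhdsWithin_le_nhds h1, self_mem_nhdsWithin] with z hz hz'
  refine ⟨hz', fun τ hτ r hr h => ?_⟩
  by_cases h0 : τ = 0
  · exact Complex.slitPlane_ne_zero hz' (by simp [h, h0])
  · have := hz τ hτ h0
    rw [h, norm_mul, Complex.norm_real, Real.norm_eq_abs, abs_of_pos (by linarith)] at this
    nlinarith [norm_pos_iff.2 h0]

theorem eventually_slitPlane_ray {p : ℂ → Prop} (h : ∀ᶠ z in 𝓝[Complex.slitPlane] 0, p z) :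
    ∀ᶠ z in 𝓝[Complex.slitPlane] 0, ∀ s : ℝ, 0 < s → s ≤ 1 → p (s * z) := by
  obtain ⟨r, hr, hp⟩ := Metric.nhdsWithin_basis_ball.eventually_iff.1 h
  refine Metric.nhdsWithin_basis_ball.eventually_iff.2 ⟨r, hr, fun z hz s hs hs1 => hp ⟨?_, ?_⟩⟩
  · have := hz.1
    rw [mem_ball_zero_iff] at this ⊢
    rw [norm_mul, Complex.norm_real, Real.norm_eq_abs, abs_of_pos hs]
    nlinarith [norm_nonneg z]
  · exact real_mul_mem_slitPlane hz.2 hs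

theorem tendsto_real_mul_slitPlane {z : ℂ} (hz : z ∈ Complex.slitPlane) :
    Tendsto (fun s : ℝ => (s : ℂ) * z) (𝓝[>] 0) (𝓝[Complex.slitPlane] 0) := by
  refine tendsto_nhdsWithin_iff.2 ⟨?_, ?_⟩
  · have : Tendsto (fun s : ℝ => (s : ℂ) * z) (𝓝 0) (𝓝 (((0 : ℝ) : ℂ) * z)) :=
      (Complex.continuous_ofReal.mul continuous_const).tendsto 0
    simp only [Complex.ofReal_zero, zero_mul] at this
    exact this.mono_left nhdsWithin_le_nhds
  · filter_upwards [self_mem_nhdsWithin] with s hs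
    exact real_mul_mem_slitPlane hz hs

end CutPlane

/-! ### Integrals along rays from 0. -/

section Ray

theorem intervalIntegrable_of_isBigO_rpow {f : ℝ → ℂ} (hf : ContinuousOn f (Set.Ioc 0 1))
    (hO : f =O[𝓝[>] 0] fun s => s ^ (-(1 / 2) : ℝ)) :
    IntervalIntegrable f MeasureTheory.volume 0 1 := by
  obtain ⟨C, hC⟩ := hO.bound
  obtain ⟨b, hb, hbC⟩ := mem_nhdsGT_iff_exists_Ioc_subset.1 hC
  have hb0 : (0 : ℝ) < b := hb
  set ε := min b 1 with hε
  have hε0 : 0 < ε := lt_min hb0 one_pos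
  refine IntervalIntegrable.trans (b := ε) ?_ ?_
  · have h1 : IntervalIntegrable (fun s : ℝ => C * s ^ (-(1 / 2) : ℝ)) MeasureTheory.volume 0 ε :=
      (intervalIntegral.intervalIntegrable_rpow' (by norm_num)).const_mul C
    refine h1.mono_fun' ?_ ?_
    · rw [Set.uIoc_of_le hε0.le]
      exact (hf.mono (Set.Ioc_subset_Ioc_right (min_le_right _ _))).aestronglyMeasurable
        measurableSet_Ioc
    · rw [Set.uIoc_of_le hε0.le]
      refine (MeasureTheory.ae_restrict_iff' measurableSet_Ioc).2 (Eventually.of_forall fun s hs => ?_)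
      have := hbC (Set.Ioc_subset_Ioc_right (min_le_left _ _) hs)
      simp only [Set.mem_ofPred_eq] at this
      rwa [Real.norm_of_nonneg (Real.rpow_nonneg hs.1.le _)] at this
  · refine ContinuousOn.intervalIntegrable (hf.mono ?_)
    rw [Set.uIcc_of_le (min_le_right _ _)]
    exact fun s hs => ⟨hε0.trans_le hs.1, hs.2⟩

theorem hasDerivAt_comp_real_mul {G : ℂ → ℂ} {z c : ℂ} {s : ℝ} (h : HasDerivAt G c (s * z)) :
    HasDerivAt (fun s : ℝ => G (s * z)) (z * c) s := by
  have h1 : HasDerivAt (fun s : ℝ => (s : ℂ) * z) z s := by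
    simpa using (Complex.ofRealCLM.hasDerivAt (x := s)).mul_const z
  rw [mul_comm]
  exact h.comp s h1

theorem integral_ray_eq {f G : ℂ → ℂ} {z : ℂ} (hz : z ∈ Complex.slitPlane) {b : ℝ} (hb : 0 < b)
    (hd : ∀ s : ℝ, 0 < s → s ≤ b → HasDerivAt G (f (s * z)) (s * z))
    (hint : IntervalIntegrable (fun s : ℝ => z * f (s * z)) MeasureTheory.volume 0 b)
    (hG : Tendsto G (𝓝[Complex.slitPlane] 0) (𝓝 0)) :
    ∫ s in (0 : ℝ)..b, z * f (s * z) = G (b * z) := by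
  have := intervalIntegral.integral_eq_sub_of_hasDerivAt_of_tendsto hb
    (f := fun s : ℝ => G (s * z)) (fa := 0) (fb := G (b * z))
    (fun s hs => hasDerivAt_comp_real_mul (hd s hs.1 hs.2.le)) hint
    (hG.comp (tendsto_real_mul_slitPlane hz))
    ((hasDerivAt_comp_real_mul (hd b hb le_rfl)).continuousAt.tendsto.mono_left
      nhdsWithin_le_nhds)
  rw [this, sub_zero]

theorem exists_convex_open_segment {U : Set ℂ} (hU : IsOpen U) {a b : ℂ}
    (hab : segment ℝ a b ⊆ U) : ∃ N, IsOpen N ∧ Convex ℝ N ∧ segment ℝ a b ⊆ N ∧ N ⊆ U := by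
  have hc : IsCompact (segment ℝ a b) := by
    rw [segment_eq_image_lineMap]
    exact isCompact_Icc.image AffineMap.lineMap_continuous
  obtain ⟨δ, hδ, hsub⟩ := hc.exists_thickening_subset_open hU hab
  exact ⟨_, Metric.isOpen_thickening, (convex_segment a b).thickening δ,
    Metric.self_subset_thickening hδ _, hsub⟩

theorem real_mul_mem_segment {a b s : ℝ} (ha : a ≤ s) (hb : s ≤ b) (z : ℂ) :
    (s : ℂ) * z ∈ segment ℝ ((a : ℂ) * z) ((b : ℂ) * z) := by
  have h : s ∈ segment ℝ a b := by
    rw [segment_eq_Icc (ha.trans hb)]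
    exact ⟨ha, hb⟩
  obtain ⟨p, q, hp, hq, hpq, rfl⟩ := h
  refine ⟨p, q, hp, hq, hpq, ?_⟩
  simp only [Complex.real_smul, smul_eq_mul, Complex.ofReal_add, Complex.ofReal_mul]
  ring

/-- A regularized primitive of `f` near `0` extends to the ray integral of `f`. -/
theorem hasDerivAt_integral_ray {U : Set ℂ} (hU : IsOpen U) (hslit : U ⊆ Complex.slitPlane)
    (hray : ∀ z ∈ U, ∀ s : ℝ, 0 < s → s ≤ 1 → (s : ℂ) * z ∈ U) {f G : ℂ → ℂ}
    (hf : DifferentiableOn ℂ f U)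
    (hint : ∀ z ∈ U, IntervalIntegrable (fun s : ℝ => z * f (s * z)) MeasureTheory.volume 0 1)
    (hG : ∀ᶠ z in 𝓝[Complex.slitPlane] 0, HasDerivAt G (f z) z)
    (hG0 : Tendsto G (𝓝[Complex.slitPlane] 0) (𝓝 0)) {z : ℂ} (hz : z ∈ U) :
    HasDerivAt (fun z => ∫ s in (0 : ℝ)..1, z * f (s * z)) (f z) z := by
  obtain ⟨r, hr, hGr⟩ := Metric.nhdsWithin_basis_ball.eventually_iff.1 (eventually_slitPlane_ray hG)
  have hev : ∀ᶠ s : ℝ in 𝓝[>] 0, (s : ℂ) * z ∈ Metric.ball (0 : ℂ) r ∩ Complex.slitPlane :=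
    tendsto_real_mul_slitPlane (hslit hz)
      (Metric.nhdsWithin_basis_ball.mem_of_mem hr)
  -- The point ε z is close enough to 0 for G to serve as a primitive on the inner part of the ray;
  -- the compact outer part [ε z, z] gets a primitive H on a convex neighbourhood.
  obtain ⟨ε, hεb, hε0, hε1⟩ := (hev.and (Ioo_mem_nhdsGT one_pos)).exists
  obtain ⟨N, hNo, hNc, hsN, hNU⟩ := exists_convex_open_segment hU (a := (ε : ℂ) * z)
    (b := ((1 : ℝ) : ℂ) * z) (by
      rintro _ ⟨p, q, hp, hq, hpq, rfl⟩
      have : p • ((ε : ℂ) * z) + q • (((1 : ℝ) : ℂ) * z) = ((p * ε + q : ℝ) : ℂ) * z := by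
        simp only [Complex.real_smul, Complex.ofReal_add, Complex.ofReal_mul, Complex.ofReal_one]
        ring
      rw [this]
      refine hray z hz _ ?_ (by nlinarith)
      rcases hp.eq_or_lt with rfl | hp
      · rw [zero_add] at hpq
        simp [hpq]
      · positivity)
  obtain ⟨H, hH⟩ := hNc.exists_forall_hasDerivWithinAt (hf.mono hNU)
  have hH' : ∀ u ∈ N, HasDerivAt H (f u) u := fun u hu => (hH u hu).hasDerivAt (hNo.mem_nhds hu)
  have hzN : z ∈ N := by simpa using hsN (right_mem_segment ℝ _ _)
  have hεN : (ε : ℂ) * z ∈ N := hsN (left_mem_segment ℝ _ _)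
  have hmulc : Continuous fun u : ℂ => (ε : ℂ) * u := continuous_const.mul continuous_id
  -- The same ε works for all u near z. On differentiating, the two contributions at ε u cancel and
  -- f z remains.
  have hformula : ∀ᶠ u in 𝓝 z, ∫ s in (0 : ℝ)..1, u * f (s * u) =
      G (ε * u) + (H u - H (ε * u)) := by
    filter_upwards [hU.mem_nhds hz, hNo.mem_nhds hzN,
      hmulc.continuousAt.preimage_mem_nhds (hNo.mem_nhds hεN),
      hmulc.continuousAt.preimage_mem_nhds
        ((Metric.isOpen_ball.inter Complex.isOpen_slitPlane).mem_nhds hεb)] with u h1 h2 h3 h4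
    have i1 : IntervalIntegrable (fun s : ℝ => u * f (s * u)) MeasureTheory.volume 0 ε :=
      (hint u h1).mono_set (by
        rw [Set.uIcc_of_le hε0.le, Set.uIcc_of_le zero_le_one]
        exact Set.Icc_subset_Icc_right hε1.le)
    have i2 : IntervalIntegrable (fun s : ℝ => u * f (s * u)) MeasureTheory.volume ε 1 :=
      (hint u h1).mono_set (by
        rw [Set.uIcc_of_le hε1.le, Set.uIcc_of_le zero_le_one]
        exact Set.Icc_subset_Icc_left hε0.le)
    rw [← intervalIntegral.integral_add_adjacent_intervals i1 i2]
    congr 1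
    · refine integral_ray_eq (hslit h1) hε0 (fun s hs hsε => ?_) i1 hG0
      have := hGr h4 (s / ε) (by positivity) ((div_le_one hε0).2 hsε)
      have e : ((s / ε : ℝ) : ℂ) * ((ε : ℂ) * u) = s * u := by
        have : (ε : ℂ) ≠ 0 := by exact_mod_cast hε0.ne'
        push_cast
        field_simp
      rwa [e] at this
    · have := intervalIntegral.integral_eq_sub_of_hasDerivAt (a := ε) (b := 1)
        (f := fun s : ℝ => H (s * u)) (f' := fun s : ℝ => u * f (s * u)) (fun s hs => by
          rw [Set.uIcc_of_le hε1.le] at hs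
          exact hasDerivAt_comp_real_mul (hH' _ (hNc.segment_subset h3 (by simpa using h2)
            (real_mul_mem_segment hs.1 hs.2 u)))) i2
      simpa using this
  have hεd : HasDerivAt (fun u : ℂ => (ε : ℂ) * u) ε z := by
    simpa using (hasDerivAt_id z).const_mul (ε : ℂ)
  have hGd : HasDerivAt G (f (ε * z)) (ε * z) := by
    simpa using hGr hεb 1 one_pos le_rfl
  have hd := (hGd.comp z hεd).add ((hH' z hzN).sub ((hH' _ hεN).comp z hεd))
  refine HasDerivAt.congr_of_eventuallyEq ?_ hformula
  convert! hd using 1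
  ring

end Ray

/-! ### Expansion at 0 and derivative of a single hyperlogarithm. -/

section Hyperlog

open Classical in
/-- The values at `0` of the coefficients of `hyperlog w` as a polynomial in `log z`. -/
noncomputable def hyperlogValues (w : List ℂ) : ℕ → ℂ :=
  if ∀ x ∈ w, x = 0 then Pi.single w.length ((w.length.factorial : ℂ)⁻¹) else 0

theorem hyperlog_of_forall_eq_zero {w : List ℂ} (hw : ∀ x ∈ w, x = 0) (z : ℂ) :
    hyperlog w z = Complex.log z ^ w.length / (w.length.factorial : ℂ) := by
  cases w with
  | nil => simp [hyperlog]
  | cons σ w =>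
    rw [hyperlog, if_pos hw]
    simp

theorem hyperlog_cons_of_not {σ : ℂ} {w : List ℂ} (hw : ¬ ∀ x ∈ σ :: w, x = 0) (z : ℂ) :
    hyperlog (σ :: w) z =
      ∫ s in (0 : ℝ)..1, z * (hyperlog w ((s : ℂ) * z) / ((s : ℂ) * z - σ)) := by
  rw [hyperlog, if_neg hw]
  congr 1
  funext s
  ring

theorem hyperlogValues_zero {w : List ℂ} (hw : w ≠ []) : hyperlogValues w 0 = 0 := by
  rw [hyperlogValues]
  split_ifs
  · rw [Pi.single_eq_of_ne]
    simpa [eq_comm] using hw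
  · rfl

/-- The kernel `z / (z - σ)`, continued to `z = 0`. -/
theorem exists_analyticAt_kernel (σ : ℂ) :
    ∃ k : ℂ → ℂ, AnalyticAt ℂ k 0 ∧ (σ ≠ 0 → k 0 = 0) ∧ ∀ z ≠ 0, (z - σ)⁻¹ = z⁻¹ * k z := by
  by_cases h : σ = 0
  · exact ⟨fun _ => 1, analyticAt_const, fun h' => (h' h).elim, fun z _ => by simp [h]⟩
  · refine ⟨fun z => z * (z - σ)⁻¹, ?_, fun _ => by simp, fun z hz => by field_simp⟩
    exact analyticAt_id.mul ((analyticAt_id.sub analyticAt_const).inv (by simpa using h))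

/-- The integrand is z⁻¹ times k(z) L_w(z) with k(z) = z / (z - σ), and this product has value 0 in
every power of log: either σ ≠ 0 and k(0) = 0, or σ = 0 and w still contains a nonzero letter. Hence
the integral converges and agrees near 0 with the regularized primitive. -/
theorem hyperlog_cons_aux {S : Set ℂ} (hS : S.Finite) {σ : ℂ} (hσ : σ ∈ S) {w : List ℂ}
    (hdiff : ∀ z ∈ cutPlane S, DifferentiableAt ℂ (hyperlog w) z)
    (hlog : LogExp (hyperlog w) (hyperlogValues w)) (hnz : ¬ ∀ x ∈ σ :: w, x = 0) :
    LogExp (hyperlog (σ :: w)) 0 ∧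
      ∀ z ∈ cutPlane S, HasDerivAt (hyperlog (σ :: w)) (hyperlog w z / (z - σ)) z := by
  obtain ⟨k, hk, hk0, hkz⟩ := exists_analyticAt_kernel σ
  have hkv : (fun i => k 0 * hyperlogValues w i) = 0 := by
    funext i
    by_cases h : σ = 0
    · have : ¬ ∀ x ∈ w, x = 0 := fun hw => hnz (by simpa [h] using hw)
      simp [hyperlogValues, this]
    · simp [hk0 h]
  have hh := hlog.analytic_mul hk
  rw [hkv] at hh
  set f : ℂ → ℂ := fun z => hyperlog w z / (z - σ) with hf
  have hfk : ∀ z ≠ 0, f z = z⁻¹ * (k z * hyperlog w z) := by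
    intro z hz
    rw [hf]
    simp only [div_eq_mul_inv, hkz z hz]
    ring
  have hfd : DifferentiableOn ℂ f (cutPlane S) := fun z hz =>
    ((hdiff z hz).div (differentiableAt_id.sub_const σ)
      (sub_ne_zero.2 (ne_of_mem_cutPlane hz hσ))).differentiableWithinAt
  obtain ⟨G, hGv, hGd⟩ := hh.exists_primitive
  have hpv : primitiveValues (0 : ℕ → ℂ) = 0 := by
    funext i
    cases i <;> simp [primitiveValues]
  rw [hpv] at hGv
  have hGd' : ∀ᶠ z in 𝓝[Complex.slitPlane] 0, HasDerivAt G (f z) z := by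
    filter_upwards [hGd, self_mem_nhdsWithin] with z hz hz'
    rw [hfk z (Complex.slitPlane_ne_zero hz')]
    simpa using hz
  have hint : ∀ z ∈ cutPlane S,
      IntervalIntegrable (fun s : ℝ => z * f (s * z)) MeasureTheory.volume 0 1 := by
    intro z hz
    refine intervalIntegrable_of_isBigO_rpow ?_ ?_
    · intro s hs
      have h1 : ContinuousAt f (s * z) := (hfd.differentiableAt ((isOpen_cutPlane hS).mem_nhds
        (real_mul_mem_cutPlane hz hs.1 hs.2))).continuousAt
      have h2 : ContinuousAt (fun s : ℝ => (s : ℂ) * z) s :=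
        (Complex.continuous_ofReal.mul continuous_const).continuousAt
      exact (continuousAt_const.mul (ContinuousAt.comp (f := fun s : ℝ => (s : ℂ) * z)
        h1 h2)).continuousWithinAt
    · have h1 := hh.isBigO.comp_tendsto (tendsto_real_mul_slitPlane hz.1)
      have h2 : (fun s : ℝ => (s : ℂ)⁻¹ * (k (s * z) * hyperlog w (s * z))) =O[𝓝[>] 0]
          fun s : ℝ => s⁻¹ * ‖(s : ℂ) * z‖ ^ (1 / 2 : ℝ) := by
        refine Asymptotics.IsBigO.mul ?_ h1
        exact Asymptotics.isBigO_of_le _ fun s => by simp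
      refine (h2.trans ?_).congr' ?_ EventuallyEq.rfl
      · refine Asymptotics.IsBigO.of_bound (‖z‖ ^ (1 / 2 : ℝ)) ?_
        filter_upwards [self_mem_nhdsWithin] with s hs
        have hs : 0 < s := hs
        have e : ‖(s : ℂ) * z‖ = s * ‖z‖ := by
          rw [norm_mul, Complex.norm_real, Real.norm_of_nonneg hs.le]
        rw [norm_mul, e, Real.mul_rpow hs.le (norm_nonneg z),
          Real.norm_of_nonneg (by positivity : 0 ≤ s⁻¹), Real.norm_of_nonneg (by positivity),
          Real.norm_of_nonneg (by positivity)]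
        have : s ^ (-(1 / 2) : ℝ) = s⁻¹ * s ^ (1 / 2 : ℝ) := by
          rw [← Real.rpow_neg_one, ← Real.rpow_add hs]
          norm_num
        rw [this]
        exact le_of_eq (by ring)
      · filter_upwards [self_mem_nhdsWithin] with s hs
        have hs : (s : ℂ) ≠ 0 := by exact_mod_cast (ne_of_gt hs)
        have hz0 := ne_zero_of_mem_cutPlane hz
        rw [hfk _ (mul_ne_zero hs hz0)]
        field_simp
  have hL : hyperlog (σ :: w) = fun z => ∫ s in (0 : ℝ)..1, z * f (s * z) := by
    funext z
    exact hyperlog_cons_of_not hnz z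
  refine ⟨hGv.congr ?_, fun z hz => ?_⟩
  · filter_upwards [eventually_slitPlane_ray hGd', eventually_mem_cutPlane hS] with z hz hzU
    rw [hL]
    simpa using integral_ray_eq hzU.1 one_pos hz (hint z hzU) hGv.tendsto_zero
  · rw [hL]
    exact hasDerivAt_integral_ray (isOpen_cutPlane hS) (fun z hz => hz.1)
      (fun z hz s hs hs1 => real_mul_mem_cutPlane hz hs hs1) hfd hint hGd' hGv.tendsto_zero hz

/-- Expansion and differentiability are needed together, since each feeds the next letter of the
induction. The set S may exceed the letters of w, so that words over one alphabet share one cut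
plane. -/
theorem hyperlog_facts {S : Set ℂ} (hS : S.Finite) {w : List ℂ} (hw : ∀ σ ∈ w, σ ∈ S) :
    LogExp (hyperlog w) (hyperlogValues w) ∧
      ∀ z ∈ cutPlane S, DifferentiableAt ℂ (hyperlog w) z ∧
        ∀ σ w', w = σ :: w' → HasDerivAt (hyperlog w) (hyperlog w' z / (z - σ)) z := by
  induction w with
  | nil =>
    refine ⟨?_, fun z _ => ⟨?_, by simp⟩⟩
    · have h : hyperlogValues [] = Pi.single 0 1 := by simp [hyperlogValues]
      rw [h]
      exact (analyticAt_const (v := (1 : ℂ))).logExp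
    · exact differentiableAt_const (1 : ℂ)
  | cons σ w ih =>
    obtain ⟨ih1, ih2⟩ := ih fun τ hτ => hw τ (by simp [hτ])
    by_cases h0 : ∀ x ∈ σ :: w, x = 0
    · have hσ0 : σ = 0 := h0 σ (by simp)
      have hL : hyperlog (σ :: w) = fun z => Complex.log z ^ (w.length + 1) •
          (((w.length + 1).factorial : ℂ)⁻¹) := by
        funext z
        rw [hyperlog_of_forall_eq_zero h0]
        simp [div_eq_mul_inv]
      have hd : ∀ z ∈ cutPlane S,
          HasDerivAt (hyperlog (σ :: w)) (hyperlog w z / (z - σ)) z := by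
        intro z hz
        rw [hL, hyperlog_of_forall_eq_zero (fun x hx => h0 x (by simp [hx])), hσ0]
        convert! (hasDerivAt_log_pow hz.1 (w.length + 1)).smul_const
          (((w.length + 1).factorial : ℂ)⁻¹) using 1
        rw [Nat.factorial_succ]
        have h1 : ((w.length : ℂ) + 1) ≠ 0 := Nat.cast_add_one_ne_zero _
        have h2 : (w.length.factorial : ℂ) ≠ 0 := by exact_mod_cast w.length.factorial_ne_zero
        have h3 := ne_zero_of_mem_cutPlane hz
        push_cast
        simp only [smul_eq_mul, sub_zero]
        field_simp
      refine ⟨?_, fun z hz => ⟨(hd z hz).differentiableAt, ?_⟩⟩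
      · rw [hyperlogValues, if_pos h0, hL]
        exact logExp_log_pow_smul (g := fun _ => (((w.length + 1).factorial : ℂ)⁻¹))
          analyticAt_const (w.length + 1)
      · rintro σ' w' h
        obtain ⟨rfl, rfl⟩ := List.cons_eq_cons.1 h
        exact hd z hz
    · obtain ⟨h1, h2⟩ := hyperlog_cons_aux hS (hw σ (by simp)) (fun z hz => (ih2 z hz).1) ih1 h0
      refine ⟨?_, fun z hz => ⟨(h2 z hz).differentiableAt, ?_⟩⟩
      · rwa [hyperlogValues, if_neg h0]
      · rintro σ' w' h
        obtain ⟨rfl, rfl⟩ := List.cons_eq_cons.1 h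
        exact h2 z hz

theorem logExp_hyperlog (w : List ℂ) : LogExp (hyperlog w) (hyperlogValues w) :=
  (hyperlog_facts (S := {σ | σ ∈ w}) (List.finite_toSet w) fun _ h => h).1

theorem hasDerivAt_hyperlog_cons {S : Set ℂ} (hS : S.Finite) {σ : ℂ} {w : List ℂ} (hσ : σ ∈ S)
    (hw : ∀ τ ∈ w, τ ∈ S) {z : ℂ} (hz : z ∈ cutPlane S) :
    HasDerivAt (hyperlog (σ :: w)) (hyperlog w z / (z - σ)) z :=
  ((hyperlog_facts hS (w := σ :: w) (by simpa using ⟨hσ, hw⟩)).2 z hz).2 σ w rfl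

theorem differentiableAt_hyperlog {S : Set ℂ} (hS : S.Finite) {w : List ℂ}
    (hw : ∀ τ ∈ w, τ ∈ S) {z : ℂ} (hz : z ∈ cutPlane S) : DifferentiableAt ℂ (hyperlog w) z :=
  ((hyperlog_facts hS hw).2 z hz).1

/-- As no letter is positive, the positive axis misses all the cuts. -/
theorem hasDerivAt_hyperlog_cons_real {σ : ℂ} {w : List ℂ}
    (hw : ∀ τ ∈ σ :: w, ∀ x : ℝ, 0 < x → τ ≠ x) {x : ℝ} (hx : 0 < x) :
    HasDerivAt (fun x : ℝ => hyperlog (σ :: w) x) (hyperlog w x / (x - σ)) x := by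
  have hxU : (x : ℂ) ∈ cutPlane {τ | τ ∈ σ :: w} := by
    refine ⟨Complex.ofReal_mem_slitPlane.2 hx, fun τ hτ r hr h => hw τ hτ (x / r) (by positivity) ?_⟩
    have : (r : ℂ) ≠ 0 := by exact_mod_cast (by linarith : r ≠ 0)
    push_cast
    rw [h]
    field_simp
  exact (hasDerivAt_hyperlog_cons (List.finite_toSet (σ :: w)) (by simp) (by simp +contextual)
    hxU).comp_ofReal

end Hyperlog

set_option linter.unusedSectionVars false

/-! ### Expansions and continuity uniform in a compact parameter space. -/

section Families

variable {X : Type*} [TopologicalSpace X] [CompactSpace X]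

/-- The family `f x p` has, uniformly in the parameter `p`, an expansion in powers of `log x` for
small `x > 0`, and `r p` is its regularized limit at `x → 0`. -/
def FamLogExp (f : ℝ → X → ℂ) (r : X → ℂ) : Prop :=
  ∃ (h : ℂ → C(X, ℂ)) (v : ℕ → C(X, ℂ)), LogExp h v ∧ (∀ p, v 0 p = r p) ∧
    ∀ᶠ x : ℝ in 𝓝[>] 0, ∀ p, f x p = h x p

/-- The family `f x p` depends on `x > 0` continuously, uniformly in the parameter `p`. -/
def FamCont (f : ℝ → X → ℂ) : Prop :=
  ∃ M : ℝ → C(X, ℂ), ContinuousOn M (Set.Ioi 0) ∧ ∀ x, 0 < x → ∀ p, M x p = f x p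

theorem FamLogExp.congr {f f' : ℝ → X → ℂ} {r r' : X → ℂ} (h : FamLogExp f r)
    (hf : ∀ᶠ x : ℝ in 𝓝[>] 0, ∀ p, f' x p = f x p) (hr : ∀ p, r' p = r p) : FamLogExp f' r' := by
  obtain ⟨g, v, h1, h2, h3⟩ := h
  refine ⟨g, v, h1, fun p => by rw [h2, hr], ?_⟩
  filter_upwards [h3, hf] with x hx hx' p
  rw [hx', hx]

theorem famLogExp_const (c : C(X, ℂ)) : FamLogExp (fun _ p => c p) c :=
  ⟨fun _ => c, Pi.single 0 c, (analyticAt_const (v := c)).logExp, fun p => by simp,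
    Eventually.of_forall fun _ _ => rfl⟩

theorem FamLogExp.add {f f' : ℝ → X → ℂ} {r r' : X → ℂ} (h : FamLogExp f r)
    (h' : FamLogExp f' r') :
    FamLogExp (fun x p => f x p + f' x p) (fun p => r p + r' p) := by
  obtain ⟨g, v, h1, h2, h3⟩ := h
  obtain ⟨g', v', h1', h2', h3'⟩ := h'
  refine ⟨_, _, h1.add h1', fun p => by simp [h2, h2'], ?_⟩
  filter_upwards [h3, h3'] with x hx hx' p
  simp [hx, hx']

theorem FamLogExp.analytic_mul {f k : ℝ → X → ℂ} {r : X → ℂ} (h : FamLogExp f r)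
    {K : ℂ → C(X, ℂ)} (hK : AnalyticAt ℂ K 0)
    (hk : ∀ᶠ x : ℝ in 𝓝[>] 0, ∀ p, k x p = K x p) :
    FamLogExp (fun x p => k x p * f x p) (fun p => K 0 p * r p) := by
  obtain ⟨g, v, h1, h2, h3⟩ := h
  refine ⟨_, _, h1.analytic_mul hK, fun p => by simp [h2], ?_⟩
  filter_upwards [h3, hk] with x hx hx' p
  simp [hx, hx']

theorem FamLogExp.const_mul {f : ℝ → X → ℂ} {r : X → ℂ} (h : FamLogExp f r) (c : C(X, ℂ)) :
    FamLogExp (fun x p => c p * f x p) (fun p => c p * r p) :=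
  h.analytic_mul (analyticAt_const (v := c)) (Eventually.of_forall fun _ _ => rfl)

theorem FamLogExp.sum {ι : Type*} (s : Finset ι) {f : ι → ℝ → X → ℂ} {r : ι → X → ℂ}
    (h : ∀ i ∈ s, FamLogExp (f i) (r i)) :
    FamLogExp (fun x p => ∑ i ∈ s, f i x p) (fun p => ∑ i ∈ s, r i p) := by
  classical
  induction s using Finset.induction_on with
  | empty => exact famLogExp_const (0 : C(X, ℂ))
  | insert a s ha ih =>
    simp only [Finset.sum_insert ha]
    exact (h a (by simp)).add (ih fun i hi => h i (by simp [hi]))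

theorem FamLogExp.eval {f : ℝ → X → ℂ} {r : X → ℂ} (h : FamLogExp f r) (p : X) :
    ∃ (φ : ℂ → ℂ) (v : ℕ → ℂ), LogExp φ v ∧ v 0 = r p ∧ ∀ᶠ x : ℝ in 𝓝[>] 0, f x p = φ x := by
  obtain ⟨g, v, h1, h2, h3⟩ := h
  exact ⟨_, _, h1.map (ContinuousMap.evalCLM ℂ p), h2 p, h3.mono fun x hx => hx p⟩

theorem FamLogExp.eventually_continuous {f : ℝ → X → ℂ} {r : X → ℂ} (h : FamLogExp f r) :
    ∀ᶠ x : ℝ in 𝓝[>] 0, Continuous (f x) := by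
  obtain ⟨g, v, h1, h2, h3⟩ := h
  filter_upwards [h3] with x hx
  rw [show f x = g x from funext hx]
  exact (g x).continuous

theorem FamLogExp.continuous_reg {f : ℝ → X → ℂ} {r : X → ℂ} (h : FamLogExp f r) :
    Continuous r := by
  obtain ⟨g, v, h1, h2, h3⟩ := h
  rw [show r = v 0 from funext fun p => (h2 p).symm]
  exact (v 0).continuous

theorem famCont_const (c : C(X, ℂ)) : FamCont (fun _ p => c p) :=
  ⟨fun _ => c, continuousOn_const, fun _ _ _ => rfl⟩

theorem FamCont.add {f f' : ℝ → X → ℂ} (h : FamCont f) (h' : FamCont f') :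
    FamCont (fun x p => f x p + f' x p) := by
  obtain ⟨M, h1, h2⟩ := h
  obtain ⟨M', h1', h2'⟩ := h'
  exact ⟨_, h1.add h1', fun x hx p => by simp [h2 x hx, h2' x hx]⟩

theorem FamCont.mul {f f' : ℝ → X → ℂ} (h : FamCont f) (h' : FamCont f') :
    FamCont (fun x p => f x p * f' x p) := by
  obtain ⟨M, h1, h2⟩ := h
  obtain ⟨M', h1', h2'⟩ := h'
  exact ⟨_, h1.mul h1', fun x hx p => by simp [h2 x hx, h2' x hx]⟩

theorem FamCont.sum {ι : Type*} (s : Finset ι) {f : ι → ℝ → X → ℂ}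
    (h : ∀ i ∈ s, FamCont (f i)) : FamCont (fun x p => ∑ i ∈ s, f i x p) := by
  classical
  induction s using Finset.induction_on with
  | empty => simpa using famCont_const (0 : C(X, ℂ))
  | insert a s ha ih =>
    simp only [Finset.sum_insert ha]
    exact (h a (by simp)).add (ih fun i hi => h i (by simp [hi]))

theorem eq_add_const_of_hasDerivAt {F G F' : ℝ → ℂ} {ε : ℝ}
    (hF : ∀ x ∈ Set.Ioo 0 ε, HasDerivAt F (F' x) x) (hG : ∀ x ∈ Set.Ioo 0 ε, HasDerivAt G (F' x) x)
    {x y : ℝ} (hx : x ∈ Set.Ioo 0 ε) (hy : y ∈ Set.Ioo 0 ε) : F x - G x = F y - G y := by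
  have hd : ∀ x ∈ Set.Ioo 0 ε, HasDerivAt (fun x => F x - G x) 0 x := fun x hx => by
    have := (hF x hx).sub (hG x hx)
    rwa [sub_self] at this
  exact isOpen_Ioo.is_const_of_deriv_eq_zero isPreconnected_Ioo
    (fun x hx => (hd x hx).differentiableAt.differentiableWithinAt)
    (fun x hx => (hd x hx).deriv) hx hy

/-- The regularized C(X, ℂ)-valued primitive and F differ, for each parameter, by a constant on an
interval (0, ε). Nothing is claimed here about how that constant depends on the parameter. -/
theorem FamLogExp.exists_primitive {f F : ℝ → X → ℂ} {r : X → ℂ} (h : FamLogExp f r)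
    (hF : ∀ᶠ x : ℝ in 𝓝[>] 0, ∀ p, HasDerivAt (fun x => F x p) ((x : ℂ)⁻¹ * f x p) x) :
    ∃ C : X → ℂ, FamLogExp (fun x p => F x p - C p) 0 := by
  obtain ⟨g, v, h1, h2, h3⟩ := h
  obtain ⟨G, hG, hGd⟩ := h1.exists_primitive
  have hev := (tendsto_ofReal_nhdsGT_slitPlane.eventually hGd).and (hF.and h3)
  obtain ⟨ε, hε, hsub⟩ := mem_nhdsGT_iff_exists_Ioo_subset.1 hev
  have hε : (0 : ℝ) < ε := hε
  have hmem : ε / 2 ∈ Set.Ioo 0 ε := ⟨by linarith, by linarith⟩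
  refine ⟨fun p => F (ε / 2) p - G ((ε / 2 : ℝ) : ℂ) p, G, _, hG, fun p => rfl, ?_⟩
  filter_upwards [Ioo_mem_nhdsGT hε] with x hx p
  have := eq_add_const_of_hasDerivAt (F := fun x => F x p) (G := fun x : ℝ => G x p)
    (F' := fun x => (x : ℂ)⁻¹ * f x p) (fun x hx => (hsub hx).2.1 p) (fun x hx => ?_) hx hmem
  · rw [← this]
    ring
  · have h4 := (ContinuousMap.evalCLM ℂ p).hasFDerivAt.comp_hasDerivAt (x : ℂ) (hsub hx).1
    have h5 := h4.comp_ofReal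
    have h6 := (hsub hx).2.2 p
    simpa [h6] using h5

/-- Upgrades pointwise differentiability in x to differentiability as a curve in C(X, ℂ): the
Banach-valued integral of f, started at one continuous slice F x₀, is identified with F by
evaluating at each parameter. -/
theorem FamCont.exists_primitive {f F : ℝ → X → ℂ} (h : FamCont f)
    (hF : ∀ x, 0 < x → ∀ p, HasDerivAt (fun x => F x p) (f x p) x) {x₀ : ℝ} (hx₀ : 0 < x₀)
    (hc : Continuous (F x₀)) :
    ∃ M M' : ℝ → C(X, ℂ), (∀ x, 0 < x → HasDerivAt M (M' x) x) ∧
      (∀ x, 0 < x → ∀ p, M x p = F x p) ∧ ∀ x, 0 < x → ∀ p, M' x p = f x p := by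
  obtain ⟨M', hM', hMf⟩ := h
  have hint : ∀ x, 0 < x → IntervalIntegrable M' MeasureTheory.volume x₀ x := fun x hx =>
    (hM'.mono fun y hy => (lt_min hx₀ hx).trans_le hy.1).intervalIntegrable
  have hd : ∀ x, 0 < x →
      HasDerivAt (fun x => (⟨F x₀, hc⟩ : C(X, ℂ)) + ∫ u in x₀..x, M' u) (M' x) x := fun x hx =>
    (intervalIntegral.integral_hasDerivAt_right (hint x hx)
      (hM'.stronglyMeasurableAtFilter isOpen_Ioi x hx)
      (hM'.continuousAt (Ioi_mem_nhds hx))).const_add _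
  refine ⟨_, M', hd, fun x hx p => ?_, hMf⟩
  have h1 := intervalIntegral.integral_eq_sub_of_hasDerivAt (a := x₀) (b := x)
    (f := fun x => F x p) (f' := fun x => M' x p) (fun y hy => by
      have hy0 : 0 < y := (lt_min hx₀ hx).trans_le hy.1
      simpa only [hMf y hy0] using hF y hy0 p)
    (((ContinuousMap.evalCLM ℝ p).continuous.comp_continuousOn hM').mono
      fun y hy => (lt_min hx₀ hx).trans_le hy.1).intervalIntegrable
  have h2 := (ContinuousMap.evalCLM ℝ p).intervalIntegral_comp_comm (hint x hx)
  simp only [ContinuousMap.evalCLM_apply] at h2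
  rw [ContinuousMap.add_apply, ← h2, h1]
  simp

theorem FamCont.of_hasDerivAt {f F : ℝ → X → ℂ} (h : FamCont f)
    (hF : ∀ x, 0 < x → ∀ p, HasDerivAt (fun x => F x p) (f x p) x) {x₀ : ℝ} (hx₀ : 0 < x₀)
    (hc : Continuous (F x₀)) : FamCont F := by
  obtain ⟨M, M', h1, h2, -⟩ := h.exists_primitive hF hx₀ hc
  exact ⟨M, fun x hx => (h1 x hx).continuousAt.continuousWithinAt, h2⟩

theorem FamCont.continuous {f : ℝ → X → ℂ} (h : FamCont f) {x : ℝ} (hx : 0 < x) :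
    Continuous (f x) := by
  obtain ⟨M, -, h2⟩ := h
  rw [show f x = M x from funext fun p => (h2 x hx p).symm]
  exact (M x).continuous

/-- Integration along a path as a continuous linear functional. -/
noncomputable def pathIntegralCLM (γ : C(ℝ, X)) : C(X, ℂ) →L[ℂ] ℂ :=
  LinearMap.mkContinuous
    { toFun := fun φ => ∫ s in (0 : ℝ)..1, φ (γ s)
      map_add' := fun φ ψ => by
        simp only [ContinuousMap.add_apply]
        exact intervalIntegral.integral_add
          ((φ.continuous.comp γ.continuous).intervalIntegrable _ _)
          ((ψ.continuous.comp γ.continuous).intervalIntegrable _ _)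
      map_smul' := fun c φ => by
        simp only [ContinuousMap.smul_apply, RingHom.id_apply]
        exact intervalIntegral.integral_smul c _ } 1 fun φ => by
    have := intervalIntegral.norm_integral_le_of_norm_le_const (a := 0) (b := 1)
      (f := fun s : ℝ => φ (γ s)) (C := ‖φ‖) fun s _ => φ.norm_coe_le_norm _
    simpa using this

theorem pathIntegralCLM_apply (γ : C(ℝ, X)) (φ : C(X, ℂ)) :
    pathIntegralCLM γ φ = ∫ s in (0 : ℝ)..1, φ (γ s) := rfl

/-- Regularized limits commute with integration over the parameter. -/
theorem FamLogExp.reg_integral {m n : ℝ → X → ℂ} {rm rn : X → ℂ} (hm : FamLogExp m rm)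
    (hn : FamLogExp n rn) (γ : C(ℝ, X)) (p q : X) (d e : ℂ)
    (h : ∀ᶠ x : ℝ in 𝓝[>] 0, m x p - m x q - d * ∫ s in (0 : ℝ)..1, n x (γ s) = e) :
    rm p - rm q - d * ∫ s in (0 : ℝ)..1, rn (γ s) = e := by
  obtain ⟨g, v, h1, h2, h3⟩ := hm
  obtain ⟨g', v', h1', h2', h3'⟩ := hn
  have hL := ((h1.map (ContinuousMap.evalCLM ℂ p)).sub (h1.map (ContinuousMap.evalCLM ℂ q))).sub
    (h1'.map (d • pathIntegralCLM γ))
  have := congrFun (hL.values_unique (analyticAt_const (v := e)).logExp (by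
    filter_upwards [h, h3, h3'] with x hx hx3 hx3'
    rw [← hx]
    simp [pathIntegralCLM_apply, hx3, hx3'])) 0
  simpa [pathIntegralCLM_apply, h2, h2'] using this

end Families

/-! ### The kernels 1 / (x - b) as functions into C(X, ℂ), at 0, at infinity and between. -/

section Kernels

variable {X : Type*} [TopologicalSpace X] [CompactSpace X]

theorem ringInverse_apply {b : C(X, ℂ)} (hb : IsUnit b) (p : X) : Ring.inverse b p = (b p)⁻¹ := by
  have h := congrArg (fun f : C(X, ℂ) => f p) (Ring.mul_inverse_cancel b hb)
  simp only [ContinuousMap.mul_apply, ContinuousMap.one_apply] at h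
  exact eq_inv_of_mul_eq_one_right h

theorem analyticAt_ringInverse_comp {A : Type*} [NormedRing A] [NormedAlgebra ℂ A]
    [CompleteSpace A] {L : ℂ → A} (hL : AnalyticAt ℂ L 0) (h0 : IsUnit (L 0)) :
    AnalyticAt ℂ (fun z => Ring.inverse (L z)) 0 ∧ ∀ᶠ z in 𝓝 0, IsUnit (L z) := by
  refine ⟨?_, hL.continuousAt.eventually (Units.isOpen.mem_nhds h0)⟩
  obtain ⟨u, hu⟩ := h0
  exact AnalyticAt.comp (g := Ring.inverse) (by rw [← hu]; exact analyticAt_inverse u) hL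

/-- The kernel `1 / (z - b)` for invertible `b` near `z = 0`. -/
theorem exists_analyticAt_inv_sub {b : C(X, ℂ)} (hb : IsUnit b) :
    ∃ K : ℂ → C(X, ℂ), AnalyticAt ℂ K 0 ∧ (∀ p, K 0 p = -(b p)⁻¹) ∧
      ∀ᶠ z in 𝓝 (0 : ℂ), ∀ p, (z - b p)⁻¹ = K z p := by
  have hL : AnalyticAt ℂ (fun z : ℂ => z • (1 : C(X, ℂ)) - b) 0 :=
    (analyticAt_id.smul analyticAt_const).sub analyticAt_const
  have h0 : IsUnit ((0 : ℂ) • (1 : C(X, ℂ)) - b) := by simpa using hb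
  obtain ⟨h1, h2⟩ := analyticAt_ringInverse_comp hL h0
  refine ⟨_, h1, fun p => ?_, ?_⟩
  · rw [ringInverse_apply h0]
    simp [inv_neg]
  · filter_upwards [h2] with z hz p
    rw [ringInverse_apply hz]
    simp

/-- The kernel `1 / (1 / y - b)` near `y = 0`. -/
theorem exists_analyticAt_inv_inv_sub (b : C(X, ℂ)) :
    ∃ K : ℂ → C(X, ℂ), AnalyticAt ℂ K 0 ∧
      ∀ᶠ y in 𝓝 (0 : ℂ), y ≠ 0 → ∀ p, (y⁻¹ - b p)⁻¹ = y * K y p := by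
  have hL : AnalyticAt ℂ (fun y : ℂ => (1 : C(X, ℂ)) - y • b) 0 :=
    analyticAt_const.sub (analyticAt_id.smul analyticAt_const)
  obtain ⟨h1, h2⟩ := analyticAt_ringInverse_comp hL (by simp)
  refine ⟨_, h1, ?_⟩
  filter_upwards [h2] with y hy hy0 p
  rw [ringInverse_apply hy]
  have : y⁻¹ - b p = y⁻¹ * (1 - y * b p) := by field_simp
  rw [this, mul_inv, inv_inv]
  simp

theorem famCont_inv_sub {b : C(X, ℂ)} (hb : ∀ p, ∀ x : ℝ, 0 < x → b p ≠ x) :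
    FamCont (fun x p => ((x : ℂ) - b p)⁻¹) := by
  have hu : ∀ x : ℝ, 0 < x → IsUnit ((x : ℂ) • (1 : C(X, ℂ)) - b) := fun x hx => by
    rw [ContinuousMap.isUnit_iff_forall_ne_zero]
    intro p
    simpa [sub_eq_zero] using (hb p x hx).symm
  refine ⟨fun x => Ring.inverse ((x : ℂ) • (1 : C(X, ℂ)) - b), fun x hx => ?_, fun x hx p => ?_⟩
  · have h1 : ContinuousAt (fun x : ℝ => (x : ℂ) • (1 : C(X, ℂ)) - b) x :=
      ((Complex.continuous_ofReal.smul continuous_const).sub continuous_const).continuousAt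
    obtain ⟨u, hu⟩ := hu x hx
    refine (ContinuousAt.comp (g := Ring.inverse) ?_ h1).continuousWithinAt
    rw [← hu]
    exact NormedRing.inverse_continuousAt u
  · rw [ringInverse_apply (hu x hx)]
    simp

end Kernels

/-! ### Hyperlogarithms with letters depending continuously on a parameter. -/

section HyperlogFamilies

variable {X : Type*} [TopologicalSpace X] [CompactSpace X] {ι : Type*} {b : ι → C(X, ℂ)}

/-- The regularized limit at `0` of the hyperlogarithm of a word. -/
def emptyIndicator {α : Type*} : List α → ℂ
  | [] => 1
  | _ :: _ => 0

theorem hyperlogValues_map_zero {α : Type*} (w : List α) (f : α → ℂ) :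
    hyperlogValues (w.map f) 0 = emptyIndicator w := by
  cases w with
  | nil => simp [hyperlogValues, emptyIndicator]
  | cons a w => rw [hyperlogValues_zero (by simp)]; rfl

theorem hasDerivAt_hyperlog_family (hb : ∀ i p, ∀ x : ℝ, 0 < x → b i p ≠ x) (i : ι) (w : List ι)
    {x : ℝ} (hx : 0 < x) (p : X) :
    HasDerivAt (fun x : ℝ => hyperlog ((i :: w).map fun i => b i p) x)
      (((x : ℂ) - b i p)⁻¹ * hyperlog (w.map fun i => b i p) x) x := by
  have := hasDerivAt_hyperlog_cons_real (σ := b i p) (w := w.map fun i => b i p) (by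
    simp only [← List.map_cons (f := fun i => b i p), List.mem_map]
    rintro _ ⟨j, -, rfl⟩
    exact hb j p) hx
  rw [div_eq_inv_mul] at this
  exact this

/-- Both at 0 and, in y = 1/x, at infinity, the differential equation has the form F' = z⁻¹ K(z) f
with K analytic into C(X, ℂ), so the expansion passes to a primitive. A letter must be identically
zero or nowhere zero for K to be analytic at 0. Continuity in between carries the continuous
dependence on the parameter from 0 to infinity. -/
theorem famLogExp_famCont_hyperlog (hb : ∀ i p, ∀ x : ℝ, 0 < x → b i p ≠ x)
    (hu : ∀ i, b i = 0 ∨ IsUnit (b i)) (w : List ι) :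
    FamLogExp (fun x p => hyperlog (w.map fun i => b i p) x) (fun _ => emptyIndicator w) ∧
    FamCont (fun x p => hyperlog (w.map fun i => b i p) x) ∧
    ∃ r, FamLogExp (fun y p => hyperlog (w.map fun i => b i p) ((y⁻¹ : ℝ) : ℂ)) r := by
  induction w with
  | nil =>
    refine ⟨famLogExp_const 1, famCont_const 1, fun _ => 1, famLogExp_const 1⟩
  | cons i w ih =>
    obtain ⟨ih1, ih2, r, ih3⟩ := ih
    have hder := fun (x : ℝ) (hx : 0 < x) (p : X) => hasDerivAt_hyperlog_family hb i w hx p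
    have h1 : FamLogExp (fun x p => hyperlog ((i :: w).map fun i => b i p) x)
        (fun _ => emptyIndicator (i :: w)) := by
      obtain ⟨K, hK, hKx⟩ : ∃ K : ℂ → C(X, ℂ), AnalyticAt ℂ K 0 ∧
          ∀ᶠ z in 𝓝 (0 : ℂ), z ≠ 0 → ∀ p, (z - b i p)⁻¹ = z⁻¹ * K z p := by
        rcases hu i with h | h
        · exact ⟨fun _ => 1, analyticAt_const, Eventually.of_forall fun z _ p => by simp [h]⟩
        · obtain ⟨K, hK, -, hKx⟩ := exists_analyticAt_inv_sub h
          refine ⟨fun z => z • K z, analyticAt_id.smul hK, ?_⟩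
          filter_upwards [hKx] with z hz hz0 p
          simp only [hz p, ContinuousMap.smul_apply, smul_eq_mul]
          field_simp
      have hKx' := tendsto_ofReal_nhdsGT_slitPlane.eventually (eventually_slitPlane_nhds hKx)
      obtain ⟨C, hC⟩ := (ih1.analytic_mul (k := fun x p => K x p) hK
        (Eventually.of_forall fun _ _ => rfl)).exists_primitive
        (F := fun x p => hyperlog ((i :: w).map fun i => b i p) x) (by
          filter_upwards [hKx', self_mem_nhdsWithin] with x hx hx0 p
          have := hder x hx0 p
          rwa [hx p, mul_assoc] at this)
      -- The constant of integration at 0 is found one parameter at a time, from the known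
      -- regularized value of a single hyperlogarithm.
      have hC0 : ∀ p, C p = 0 := by
        intro p
        obtain ⟨φ, v, hv, hv0, hφ⟩ := hC.eval p
        have h2 := (logExp_hyperlog ((i :: w).map fun i => b i p)).sub
          (analyticAt_const (v := C p)).logExp
        have h3 := congrFun (h2.values_unique hv hφ) 0
        rw [hv0, Pi.sub_apply, hyperlogValues_map_zero] at h3
        simpa [emptyIndicator] using h3
      exact hC.congr (Eventually.of_forall fun x p => by simp [hC0]) (fun p => rfl)
    have h2 : FamCont (fun x p => hyperlog ((i :: w).map fun i => b i p) x) := by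
      obtain ⟨x₀, hc, hx₀⟩ := (h1.eventually_continuous.and self_mem_nhdsWithin).exists
      exact ((famCont_inv_sub (hb i)).mul ih2).of_hasDerivAt hder hx₀ hc
    refine ⟨h1, h2, ?_⟩
    obtain ⟨K, hK, hKx⟩ := exists_analyticAt_inv_inv_sub (b i)
    have hKx' := tendsto_ofReal_nhdsGT_slitPlane.eventually (eventually_slitPlane_nhds hKx)
    obtain ⟨C, hC⟩ := (ih3.analytic_mul (k := fun x p => -K x p) hK.neg
      (Eventually.of_forall fun _ _ => rfl)).exists_primitive
      (F := fun y p => hyperlog ((i :: w).map fun i => b i p) ((y⁻¹ : ℝ) : ℂ)) (by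
        filter_upwards [hKx', self_mem_nhdsWithin] with y hy hy0 p
        have hy0 : 0 < y := hy0
        have hyc : (y : ℂ) ≠ 0 := by exact_mod_cast hy0.ne'
        have h4 := (hder y⁻¹ (inv_pos.2 hy0) p).scomp y (hasDerivAt_inv hy0.ne')
        convert! h4 using 1
        rw [Complex.real_smul]
        push_cast
        rw [hy p]
        field_simp)
    obtain ⟨y, hy, hy0⟩ := (hC.eventually_continuous.and self_mem_nhdsWithin).exists
    -- At infinity the constant of integration is the regularized limit itself. It is continuous
    -- because it is the difference of two continuous slices at one y.
    have hCc : Continuous C := by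
      refine ((h2.continuous (inv_pos.2 hy0)).sub hy).congr fun p => ?_
      simp
    refine ⟨C, (hC.add (famLogExp_const ⟨C, hCc⟩)).congr
      (Eventually.of_forall fun x p => by simp) (fun p => by simp)⟩

end HyperlogFamilies

/-! ### The combinatorial derivation on words. -/

section WordDeriv

variable {ι : Type*}

/-- The linear extension of a function on words to formal combinations of words. -/
noncomputable def wordSum (v : List ι →₀ ℚ) (Λ : List ι → ℂ) : ℂ := v.sum fun u q => (q : ℂ) * Λ u

theorem wordSum_zero (Λ : List ι → ℂ) : wordSum 0 Λ = 0 := Finsupp.sum_zero_index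

theorem wordSum_zero_right (v : List ι →₀ ℚ) : wordSum v (fun _ => 0) = 0 := by
  simp [wordSum]

theorem wordSum_add (v v' : List ι →₀ ℚ) (Λ : List ι → ℂ) :
    wordSum (v + v') Λ = wordSum v Λ + wordSum v' Λ :=
  Finsupp.sum_add_index' (by simp) (by intros; push_cast; ring)

theorem wordSum_single (u : List ι) (q : ℚ) (Λ : List ι → ℂ) :
    wordSum (Finsupp.single u q) Λ = q * Λ u :=
  Finsupp.sum_single_index (by simp)

theorem wordSum_mapDomain (v : List ι →₀ ℚ) (f : List ι → List ι) (Λ : List ι → ℂ) :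
    wordSum (v.mapDomain f) Λ = wordSum v fun u => Λ (f u) :=
  Finsupp.sum_mapDomain_index (by simp) (by intros; push_cast; ring)

theorem wordSum_smul (c : ℚ) (v : List ι →₀ ℚ) (Λ : List ι → ℂ) :
    wordSum (c • v) Λ = c * wordSum v Λ := by
  rw [wordSum, Finsupp.sum_smul_index (by simp), wordSum, Finsupp.mul_sum]
  simp only [Finsupp.sum]
  push_cast
  simp only [mul_assoc]

theorem wordSum_mul_left (c : ℂ) (v : List ι →₀ ℚ) (Λ : List ι → ℂ) :
    wordSum v (fun u => c * Λ u) = c * wordSum v Λ := by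
  simp only [wordSum, Finsupp.sum, Finset.mul_sum]
  exact Finset.sum_congr rfl fun _ _ => by ring

/-- The part of the total derivative of a hyperlogarithm which belongs to one zero or pole `τ`
of the differences of letters; `m i j` is the order of `i - j` at `τ`, and `o` is the letter `0`. -/
noncomputable def wordDeriv (m : ι → ι → ℚ) (o : ι) : List ι → (List ι →₀ ℚ)
  | [] => 0
  | [i] => Finsupp.single [] (-m i o)
  | i :: j :: w => (wordDeriv m o (j :: w)).mapDomain (List.cons i) +
      (Finsupp.single (i :: w) (m i j) + Finsupp.single (j :: w) (-m i j))

theorem wordSum_wordDeriv_cons_cons (m : ι → ι → ℚ) (o i j : ι) (w : List ι) (Λ : List ι → ℂ) :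
    wordSum (wordDeriv m o (i :: j :: w)) Λ =
      wordSum (wordDeriv m o (j :: w)) (fun u => Λ (i :: u)) +
        m i j * (Λ (i :: w) - Λ (j :: w)) := by
  rw [wordDeriv, wordSum_add, wordSum_add, wordSum_mapDomain, wordSum_single, wordSum_single]
  push_cast
  ring

theorem wordSum_wordDeriv_singleton (m : ι → ι → ℚ) (o i : ι) (Λ : List ι → ℂ) :
    wordSum (wordDeriv m o [i]) Λ = -m i o * Λ [] := by
  rw [wordDeriv, wordSum_single]
  push_cast
  rfl

theorem length_of_mem_support_wordDeriv (m : ι → ι → ℚ) (o : ι) (w : List ι) :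
    ∀ u ∈ (wordDeriv m o w).support, u.length + 1 = w.length := by
  classical
  induction w with
  | nil => simp [wordDeriv]
  | cons i w ih =>
    cases w with
    | nil =>
      intro u hu
      have := Finsupp.support_single_subset hu
      simp_all
    | cons j w =>
      intro u hu
      rcases Finset.mem_union.1 (Finsupp.support_add hu) with h | h
      · obtain ⟨u', hu', rfl⟩ := Finset.mem_image.1 (Finsupp.mapDomain_support h)
        simp [ih u' hu']
      · rcases Finset.mem_union.1 (Finsupp.support_add h) with h | h <;>
        · have := Finsupp.support_single_subset h
          simp_all

theorem hasDerivAt_wordSum {Λ : List ι → ℝ → ℂ} {Λ' : List ι → ℂ} {x : ℝ}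
    (h : ∀ u, HasDerivAt (Λ u) (Λ' u) x) (v : List ι →₀ ℚ) :
    HasDerivAt (fun x => wordSum v fun u => Λ u x) (wordSum v Λ') x :=
  HasDerivAt.fun_sum fun u _ => (h u).const_mul _

end WordDeriv

/-! ### Derivatives in the parameter via integrals over segments. -/

section Segment

/-- The segment from the centre of a closed ball to a point of the ball. -/
noncomputable def ballSegment {t₀ : ℂ} {ρ : ℝ} (t : Metric.closedBall t₀ ρ) : C(ℝ, Metric.closedBall t₀ ρ) where
  toFun s := ⟨t₀ + (Set.projIcc (0 : ℝ) 1 zero_le_one s : ℝ) * (t - t₀), by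
    have h1 := (Set.projIcc (0 : ℝ) 1 zero_le_one s).2
    have h2 := t.2
    rw [mem_closedBall_iff_norm] at h2 ⊢
    rw [add_sub_cancel_left, norm_mul, Complex.norm_real, Real.norm_of_nonneg h1.1]
    exact (mul_le_of_le_one_left (norm_nonneg _) h1.2).trans h2⟩
  continuous_toFun := by
    refine Continuous.subtype_mk (continuous_const.add (Continuous.mul ?_ continuous_const)) _
    exact Complex.continuous_ofReal.comp (continuous_subtype_val.comp continuous_projIcc)

theorem ballSegment_apply {t₀ : ℂ} {ρ : ℝ} (t : Metric.closedBall t₀ ρ) {s : ℝ}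
    (hs : s ∈ Set.Icc (0 : ℝ) 1) : (ballSegment t s : ℂ) = t₀ + s * (t - t₀) := by
  simp [ballSegment, Set.projIcc_of_mem zero_le_one hs]

theorem ballSegment_dist {t₀ : ℂ} {ρ : ℝ} (t : Metric.closedBall t₀ ρ) (s : ℝ) :
    dist (ballSegment t s : ℂ) t₀ ≤ dist (t : ℂ) t₀ := by
  have h1 := (Set.projIcc (0 : ℝ) 1 zero_le_one s).2
  simp only [dist_eq_norm, ballSegment, ContinuousMap.coe_mk, add_sub_cancel_left, norm_mul,
    Complex.norm_real, Real.norm_of_nonneg h1.1]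
  exact mul_le_of_le_one_left (norm_nonneg _) h1.2

theorem sub_eq_mul_integral_ballSegment {f : ℂ → ℂ} {t₀ : ℂ} {ρ : ℝ}
    {g : Metric.closedBall t₀ ρ → ℂ} (hg : Continuous g)
    (hf : ∀ p : Metric.closedBall t₀ ρ, HasDerivAt f (g p) p) (t : Metric.closedBall t₀ ρ) :
    f t - f t₀ = (t - t₀) * ∫ s in (0 : ℝ)..1, g (ballSegment t s) := by
  have hline : ∀ s : ℝ, HasDerivAt (fun s : ℝ => t₀ + (s : ℂ) * ((t : ℂ) - t₀)) (t - t₀) s := by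
    intro s
    simpa using ((Complex.ofRealCLM.hasDerivAt (x := s)).mul_const ((t : ℂ) - t₀)).const_add t₀
  have := intervalIntegral.integral_eq_sub_of_hasDerivAt (a := 0) (b := 1)
    (f := fun s : ℝ => f (t₀ + s * (t - t₀)))
    (f' := fun s : ℝ => (t - t₀) * g (ballSegment t s)) (fun s hs => by
      rw [Set.uIcc_of_le zero_le_one] at hs
      have h1 := hf (ballSegment t s)
      rw [ballSegment_apply t hs] at h1
      rw [mul_comm]
      exact HasDerivAt.comp s h1 (hline s))
    ((continuous_const.mul (hg.comp (ballSegment t).continuous)).intervalIntegrable _ _)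
  rw [intervalIntegral.integral_const_mul] at this
  rw [this]
  simp

/-- A converse to the fundamental theorem of calculus. It recovers a derivative from an integral
identity alone, which, unlike a difference quotient, survives regularization. -/
theorem hasDerivAt_of_eq_mul_integral_ballSegment {f : ℂ → ℂ} {t₀ : ℂ} {ρ : ℝ} (hρ : 0 < ρ)
    {g : Metric.closedBall t₀ ρ → ℂ} (hg : Continuous g)
    (hf : ∀ t : Metric.closedBall t₀ ρ,
      f t - f t₀ = (t - t₀) * ∫ s in (0 : ℝ)..1, g (ballSegment t s)) :
    HasDerivAt f (g ⟨t₀, Metric.mem_closedBall_self hρ.le⟩) t₀ := by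
  rw [hasDerivAt_iff_isLittleO, Asymptotics.isLittleO_iff]
  intro ε hε
  obtain ⟨δ, hδ, hgδ⟩ := Metric.continuousAt_iff.1
    (hg.continuousAt (x := ⟨t₀, Metric.mem_closedBall_self hρ.le⟩)) ε hε
  filter_upwards [Metric.ball_mem_nhds t₀ (lt_min hδ hρ)] with t ht
  have ht1 : dist t t₀ < δ := (Metric.mem_ball.1 ht).trans_le (min_le_left _ _)
  have ht2 : t ∈ Metric.closedBall t₀ ρ :=
    ((Metric.mem_ball.1 ht).trans_le (min_le_right _ _)).le
  have hcont : Continuous fun s => g (ballSegment ⟨t, ht2⟩ s) :=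
    hg.comp (ballSegment ⟨t, ht2⟩).continuous
  have h1 := hf ⟨t, ht2⟩
  simp only at h1
  have h2 : (∫ s in (0 : ℝ)..1, g (ballSegment ⟨t, ht2⟩ s)) -
      g ⟨t₀, Metric.mem_closedBall_self hρ.le⟩ = ∫ s in (0 : ℝ)..1,
        (g (ballSegment ⟨t, ht2⟩ s) - g ⟨t₀, Metric.mem_closedBall_self hρ.le⟩) := by
    rw [intervalIntegral.integral_sub (hcont.intervalIntegrable _ _) (by simp)]
    simp
  rw [h1, smul_eq_mul, ← mul_sub, h2, norm_mul, mul_comm]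
  refine mul_le_mul_of_nonneg_right ?_ (norm_nonneg _)
  have := intervalIntegral.norm_integral_le_of_norm_le_const (a := 0) (b := 1)
    (f := fun s : ℝ => g (ballSegment ⟨t, ht2⟩ s) - g ⟨t₀, Metric.mem_closedBall_self hρ.le⟩)
    (C := ε) fun s _ => by
      rw [← dist_eq_norm]
      refine (hgδ ?_).le
      rw [Subtype.dist_eq]
      exact (ballSegment_dist _ s).trans_lt ht1
  simpa using this

end Segment

/-! ### Abstract letters and the x-derivative of the candidate for ∂_t L_w. -/

section LetterSystem

variable {ι : Type*}

/-- Letters `a i` holomorphic on `D` and off `(0, ∞)`, of which `o` is zero and the others are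
nowhere zero, with `∑ τ, m τ i j / (t - τ)` the logarithmic derivative of `a i - a j`. -/
structure LetterSystem (a : ι → ℂ → ℂ) (D : Set ℂ) (T : Finset ℂ) (m : ℂ → ι → ι → ℚ)
    (o : ι) : Prop where
  isOpen : IsOpen D
  differentiableOn : ∀ i, DifferentiableOn ℂ (a i) D
  ne_pos : ∀ i, ∀ t ∈ D, ∀ x : ℝ, 0 < x → a i t ≠ x
  eq_zero : ∀ t ∈ D, a o t = 0
  ne_zero : ∀ i, i ≠ o → ∀ t ∈ D, a i t ≠ 0
  notMem : ∀ τ ∈ T, τ ∉ D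
  self_eq_zero : ∀ τ i, m τ i i = 0
  deriv_sub : ∀ i j, ∀ t ∈ D, deriv (a i) t - deriv (a j) t =
    (∑ τ ∈ T, (t - τ)⁻¹ * m τ i j) * (a i t - a j t)

/-- The hyperlogarithm of a word at `x`, the letters being evaluated at `t`. -/
noncomputable def letterLog (a : ι → ℂ → ℂ) (w : List ι) (x : ℝ) (t : ℂ) : ℂ :=
  hyperlog (w.map fun i => a i t) x

/-- The boundary term in the derivative of a hyperlogarithm with respect to the parameter. -/
noncomputable def headTerm (a : ι → ℂ → ℂ) (w : List ι) (x : ℝ) (t : ℂ) : ℂ :=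
  match w with
  | [] => 0
  | i :: w => deriv (a i) t * (((x : ℂ) - a i t)⁻¹ * letterLog a w x t)

/-- The derivative of a hyperlogarithm with respect to the parameter. -/
noncomputable def paramDeriv (a : ι → ℂ → ℂ) (T : Finset ℂ) (m : ℂ → ι → ι → ℚ) (o : ι)
    (w : List ι) (x : ℝ) (t : ℂ) : ℂ :=
  ∑ τ ∈ T, (t - τ)⁻¹ * wordSum (wordDeriv (m τ) o w) (fun u => letterLog a u x t) -
    headTerm a w x t

variable {a : ι → ℂ → ℂ} {D : Set ℂ} {T : Finset ℂ} {m : ℂ → ι → ι → ℚ} {o : ι}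

namespace LetterSystem

theorem deriv_zero (h : LetterSystem a D T m o) {t : ℂ} (ht : t ∈ D) : deriv (a o) t = 0 := by
  have : a o =ᶠ[𝓝 t] fun _ => 0 := by
    filter_upwards [h.isOpen.mem_nhds ht] with s hs using h.eq_zero s hs
  rw [this.deriv_eq, deriv_const]

theorem deriv_eq (h : LetterSystem a D T m o) (i : ι) {t : ℂ} (ht : t ∈ D) :
    deriv (a i) t = (∑ τ ∈ T, (t - τ)⁻¹ * m τ i o) * a i t := by
  have := h.deriv_sub i o t ht
  rwa [h.deriv_zero ht, h.eq_zero t ht, sub_zero, sub_zero] at this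

theorem sub_ne_zero_of_pos (h : LetterSystem a D T m o) (i : ι) {t : ℂ} (ht : t ∈ D) {x : ℝ}
    (hx : 0 < x) : (x : ℂ) - a i t ≠ 0 :=
  sub_ne_zero.2 (h.ne_pos i t ht x hx).symm

theorem hasDerivAt_letterLog_cons (h : LetterSystem a D T m o) (i : ι) (w : List ι) {t : ℂ}
    (ht : t ∈ D) {x : ℝ} (hx : 0 < x) :
    HasDerivAt (fun x => letterLog a (i :: w) x t) (((x : ℂ) - a i t)⁻¹ * letterLog a w x t) x := by
  have := hasDerivAt_hyperlog_cons_real (σ := a i t) (w := w.map fun i => a i t) (by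
    simp only [← List.map_cons (f := fun i => a i t), List.mem_map]
    rintro _ ⟨j, -, rfl⟩
    exact h.ne_pos j t ht) hx
  rw [div_eq_inv_mul] at this
  exact this

/-- The right side is what ∂_t of (x - a_i)⁻¹ L_w will be once ∂_t L_w is known. With κ_i = (x -
a_i)⁻¹, partial fractions κ_i - κ_j = (a_i - a_j) κ_i κ_j and the logarithmic derivative of a_i -
a_j turn the new terms of the derivation into (a_i' - a_j') κ_i κ_j L_w. The a_i' part cancels
against the new boundary term, and the a_j' part is the boundary term of the shorter word. -/
theorem hasDerivAt_paramDeriv_cons (h : LetterSystem a D T m o) (i : ι) (w : List ι) {t : ℂ}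
    (ht : t ∈ D) {x : ℝ} (hx : 0 < x) :
    HasDerivAt (fun x => paramDeriv a T m o (i :: w) x t)
      (((x : ℂ) - a i t)⁻¹ * paramDeriv a T m o w x t +
        deriv (a i) t * (((x : ℂ) - a i t)⁻¹ * (((x : ℂ) - a i t)⁻¹ * letterLog a w x t))) x := by
  have hκ : ∀ j, HasDerivAt (fun x : ℝ => ((x : ℂ) - a j t)⁻¹)
      (-(((x : ℂ) - a j t)⁻¹ * ((x : ℂ) - a j t)⁻¹)) x := by
    intro j
    have h1 : HasDerivAt (fun x : ℝ => (x : ℂ) - a j t) 1 x := by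
      simpa using (Complex.ofRealCLM.hasDerivAt (x := x)).sub_const (a j t)
    have h2 := h1.fun_inv (h.sub_ne_zero_of_pos j ht hx)
    convert! h2 using 1
    field_simp
  cases w with
  | nil =>
    have h3 := ((hκ i).mul_const (1 : ℂ)).const_mul (deriv (a i) t)
    have h4 := h3.const_sub (∑ τ ∈ T, (t - τ)⁻¹ *
      wordSum (wordDeriv (m τ) o [i]) (fun u => emptyIndicator u))
    convert! h4 using 1
    · funext x
      simp [paramDeriv, headTerm, letterLog, hyperlog, wordSum_wordDeriv_singleton, emptyIndicator]
    · simp [paramDeriv, headTerm, letterLog, hyperlog, wordDeriv, wordSum_zero]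
  | cons j w =>
    have h1 : ∀ τ ∈ T, HasDerivAt (fun x => (t - τ)⁻¹ *
        wordSum (wordDeriv (m τ) o (i :: j :: w)) (fun u => letterLog a u x t))
        ((t - τ)⁻¹ * (((x : ℂ) - a i t)⁻¹ *
          wordSum (wordDeriv (m τ) o (j :: w)) (fun u => letterLog a u x t) +
          m τ i j * (((x : ℂ) - a i t)⁻¹ * letterLog a w x t -
            ((x : ℂ) - a j t)⁻¹ * letterLog a w x t))) x := by
      intro τ _
      simp only [wordSum_wordDeriv_cons_cons]
      have h2 := hasDerivAt_wordSum (Λ := fun u x => letterLog a (i :: u) x t)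
        (fun u => h.hasDerivAt_letterLog_cons i u ht hx) (wordDeriv (m τ) o (j :: w))
      rw [wordSum_mul_left] at h2
      exact (h2.add (((h.hasDerivAt_letterLog_cons i w ht hx).sub
        (h.hasDerivAt_letterLog_cons j w ht hx)).const_mul _)).const_mul _
    have h2 := ((hκ i).mul (h.hasDerivAt_letterLog_cons j w ht hx)).const_mul (deriv (a i) t)
    have h3 := (HasDerivAt.fun_sum h1).sub h2
    convert! h3 using 1
    have h4 := h.deriv_sub i j t ht
    have hi := h.sub_ne_zero_of_pos i ht hx
    have hj := h.sub_ne_zero_of_pos j ht hx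
    have h5 : ∑ τ ∈ T, (t - τ)⁻¹ * (((x : ℂ) - a i t)⁻¹ *
          wordSum (wordDeriv (m τ) o (j :: w)) (fun u => letterLog a u x t) +
          m τ i j * (((x : ℂ) - a i t)⁻¹ * letterLog a w x t -
            ((x : ℂ) - a j t)⁻¹ * letterLog a w x t)) =
        ((x : ℂ) - a i t)⁻¹ * (∑ τ ∈ T, (t - τ)⁻¹ *
          wordSum (wordDeriv (m τ) o (j :: w)) (fun u => letterLog a u x t)) +
        (∑ τ ∈ T, (t - τ)⁻¹ * m τ i j) * (((x : ℂ) - a i t)⁻¹ * letterLog a w x t -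
            ((x : ℂ) - a j t)⁻¹ * letterLog a w x t) := by
      rw [Finset.mul_sum, Finset.sum_mul, ← Finset.sum_add_distrib]
      exact Finset.sum_congr rfl fun _ _ => by ring
    have h6 : ((x : ℂ) - a i t)⁻¹ - ((x : ℂ) - a j t)⁻¹ =
        (a i t - a j t) * (((x : ℂ) - a i t)⁻¹ * ((x : ℂ) - a j t)⁻¹) := by
      field_simp
      ring
    have h7 : (∑ τ ∈ T, (t - τ)⁻¹ * m τ i j) * (((x : ℂ) - a i t)⁻¹ * letterLog a w x t -
            ((x : ℂ) - a j t)⁻¹ * letterLog a w x t) = (deriv (a i) t - deriv (a j) t) *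
        (((x : ℂ) - a i t)⁻¹ * ((x : ℂ) - a j t)⁻¹) * letterLog a w x t := by
      rw [h4, ← sub_mul, h6]
      ring
    rw [h5, h7, paramDeriv, headTerm]
    ring

end LetterSystem

end LetterSystem

/-! ### Regularized limits at infinity. -/

section RegLim

/-- The substitution y = 1/x turns log x into -log y, so the i-th coefficient changes by (-1)^i; the
zeroth, which carries the limit, is unaffected. -/
theorem hasRegLimInf_iff {f : ℂ → ℂ} {c : ℂ} :
    HasRegLimInf f c ↔ ∃ (φ : ℂ → ℂ) (v : ℕ → ℂ), LogExp φ v ∧ v 0 = c ∧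
      ∀ᶠ y : ℝ in 𝓝[>] 0, f ((y⁻¹ : ℝ) : ℂ) = φ y := by
  have hlog : ∀ y : ℝ, Complex.log ((y⁻¹ : ℝ) : ℂ) = -Complex.log y ∨ y ≤ 0 := by
    intro y
    rcases le_or_gt y 0 with h | h
    · exact Or.inr h
    · left
      rw [← Complex.ofReal_log (inv_pos.2 h).le, ← Complex.ofReal_log h.le, Real.log_inv]
      simp
  constructor
  · rintro ⟨n, g, h1, h2, h3⟩
    set g' : ℕ → ℂ → ℂ := fun i => if i < n + 1 then fun z => (-1) ^ i * g i z else 0 with hg'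
    have hg'' : ∀ i, i < n + 1 → g' i = fun z => (-1) ^ i * g i z := fun i hi => if_pos hi
    refine ⟨fun z => ∑ i ∈ Finset.range (n + 1), Complex.log z ^ i • g' i z, fun i => g' i 0,
      ⟨n + 1, g', fun i => ?_, fun i => rfl, fun i hi => ?_, Eventually.of_forall fun z => rfl⟩,
      ?_, ?_⟩
    · by_cases hi : i < n + 1
      · rw [hg'' i hi]
        exact analyticAt_const.mul (h1 i)
      · simp only [hg', hi, if_false]
        exact analyticAt_const
    · exact if_neg (not_lt.2 hi)
    · simp [hg', h2]
    · filter_upwards [tendsto_inv_nhdsGT_zero.eventually h3, self_mem_nhdsWithin] with y hy hy0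
      rw [hy]
      refine Finset.sum_congr rfl fun i hi => ?_
      rw [hg'' i (Finset.mem_range.1 hi), (hlog y).resolve_right (not_le.2 hy0)]
      simp only [Complex.ofReal_inv, inv_inv, smul_eq_mul, neg_pow (Complex.log (y : ℂ))]
      ring
  · rintro ⟨φ, v, ⟨n, g, h1, h2, h3, h4⟩, h5, h6⟩
    refine ⟨n, fun i z => (-1) ^ i * g i z, fun i => analyticAt_const.mul (h1 i), by simp [h2, h5],
      ?_⟩
    filter_upwards [tendsto_inv_atTop_nhdsGT_zero.eventually h6,
      tendsto_inv_atTop_nhdsGT_zero.eventually (tendsto_ofReal_nhdsGT_slitPlane.eventually h4),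
      eventually_gt_atTop 0] with x hx1 hx2 hx0
    rw [inv_inv] at hx1
    rw [hx1, hx2, sum_range_eq_of_vanish n.le_succ _ fun i hi => by simp [h3 i hi],
      (hlog x).resolve_right (not_le.2 hx0)]
    refine Finset.sum_congr rfl fun i _ => ?_
    simp only [Complex.ofReal_inv, smul_eq_mul, neg_pow (Complex.log (x : ℂ))]
    ring

theorem HasRegLimInf.unique {f : ℂ → ℂ} {c c' : ℂ} (h : HasRegLimInf f c)
    (h' : HasRegLimInf f c') : c = c' := by
  obtain ⟨φ, v, h1, rfl, h3⟩ := hasRegLimInf_iff.1 h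
  obtain ⟨φ', v', h1', rfl, h3'⟩ := hasRegLimInf_iff.1 h'
  rw [h1.values_unique h1' (by filter_upwards [h3, h3'] with y hy hy'; rw [← hy, hy'])]

theorem HasRegLimInf.regLimInf_eq {f : ℂ → ℂ} {c : ℂ} (h : HasRegLimInf f c) :
    regLimInf f = c := by
  have hex : ∃ c, HasRegLimInf f c := ⟨c, h⟩
  rw [regLimInf, dif_pos hex]
  exact hex.choose_spec.unique h

theorem hasRegLimInf_wordSum {ι : Type*} {f : List ι → ℂ → ℂ} {c : List ι → ℂ}
    (h : ∀ u, HasRegLimInf (f u) (c u)) (w : List ι →₀ ℚ) :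
    HasRegLimInf (fun z => wordSum w fun u => f u z) (wordSum w c) := by
  choose φ v h1 h2 h3 using fun u => hasRegLimInf_iff.1 (h u)
  refine hasRegLimInf_iff.2 ⟨fun z => wordSum w fun u => φ u z, fun i => wordSum w fun u => v u i,
    ?_, by simp [h2], ?_⟩
  · convert! LogExp.sum w.support fun u _ => (h1 u).const_smul (w u : ℂ) using 1
    funext i
    simp [wordSum, Finsupp.sum]
  · have : ∀ᶠ y : ℝ in 𝓝[>] 0, ∀ u ∈ w.support, f u ((y⁻¹ : ℝ) : ℂ) = φ u y :=
      (eventually_all_finset _).2 fun u _ => h3 u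
    filter_upwards [this] with y hy
    exact Finset.sum_congr rfl fun u hu => by simp only [hy u hu]

end RegLim

/-! ### The parameter derivative of hyperlogarithms and of their regularized limits. -/

section LetterSystem

variable {ι : Type*} {a : ι → ℂ → ℂ} {D : Set ℂ} {T : Finset ℂ} {m : ℂ → ι → ι → ℚ} {o : ι}

/-- The regularized limit at infinity of a hyperlogarithm as a function of the parameter. -/
noncomputable def letterReg (a : ι → ℂ → ℂ) (w : List ι) (t : ℂ) : ℂ :=
  regLimInf fun z => hyperlog (w.map fun i => a i t) z

theorem FamLogExp.hasRegLimInf {X : Type*} [TopologicalSpace X] [CompactSpace X]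
    {w : List ι} {s : X → ℂ} {r : X → ℂ}
    (h : FamLogExp (fun y p => letterLog a w y⁻¹ (s p)) r) (p : X) :
    HasRegLimInf (fun z => hyperlog (w.map fun i => a i (s p)) z) (r p) := by
  obtain ⟨φ, v, h1, h2, h3⟩ := h.eval p
  exact hasRegLimInf_iff.2 ⟨φ, v, h1, h2, h3⟩

namespace LetterSystem

/-- A continuous function on `D` as a function on a closed ball in `D`. -/
def restrictBall {t₀ : ℂ} {ρ : ℝ} (hρ : Metric.closedBall t₀ ρ ⊆ D) {f : ℂ → ℂ}
    (hf : ContinuousOn f D) : C(Metric.closedBall t₀ ρ, ℂ) :=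
  ⟨fun p => f p, hf.comp_continuous continuous_subtype_val fun p => hρ p.2⟩

variable {t₀ : ℂ} {ρ : ℝ}

theorem continuousOn_inv_sub (h : LetterSystem a D T m o) {τ : ℂ} (hτ : τ ∈ T) :
    ContinuousOn (fun t => (t - τ)⁻¹) D :=
  (continuous_id.sub continuous_const).continuousOn.inv₀ fun t ht h0 =>
    h.notMem τ hτ ((sub_eq_zero.1 h0 : t = τ) ▸ ht)

theorem continuousOn_deriv (h : LetterSystem a D T m o) (i : ι) : ContinuousOn (deriv (a i)) D :=
  ((h.differentiableOn i).deriv h.isOpen).continuousOn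

theorem fam_letterLog (h : LetterSystem a D T m o) (hρ : Metric.closedBall t₀ ρ ⊆ D)
    (w : List ι) :
    FamLogExp (fun x (p : Metric.closedBall t₀ ρ) => letterLog a w x p)
      (fun _ => emptyIndicator w) ∧
    FamCont (fun x (p : Metric.closedBall t₀ ρ) => letterLog a w x p) ∧
    FamLogExp (fun y (p : Metric.closedBall t₀ ρ) => letterLog a w y⁻¹ p)
      (fun p => letterReg a w p) := by
  have hb := famLogExp_famCont_hyperlog
    (b := fun i => restrictBall hρ (h.differentiableOn i).continuousOn)
    (fun i p => h.ne_pos i p (hρ p.2)) (fun i => by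
      by_cases hi : i = o
      · left
        ext p
        rw [hi]
        exact h.eq_zero p (hρ p.2)
      · right
        rw [ContinuousMap.isUnit_iff_forall_ne_zero]
        exact fun p => h.ne_zero i hi p (hρ p.2)) w
  obtain ⟨h1, h2, r, h3⟩ := hb
  refine ⟨h1, h2, h3.congr (Eventually.of_forall fun _ _ => rfl) fun p => ?_⟩
  exact (FamLogExp.hasRegLimInf (s := Subtype.val) h3 p).regLimInf_eq

theorem hasRegLimInf (h : LetterSystem a D T m o) (w : List ι) {t : ℂ} (ht : t ∈ D) :
    HasRegLimInf (fun z => hyperlog (w.map fun i => a i t) z) (letterReg a w t) := by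
  obtain ⟨ρ, hρ0, hρ⟩ := Metric.nhds_basis_closedBall.mem_iff.1 (h.isOpen.mem_nhds ht)
  exact FamLogExp.hasRegLimInf (s := Subtype.val) (h.fam_letterLog hρ w).2.2
    ⟨t, Metric.mem_closedBall_self hρ0.le⟩

theorem famLogExp_wordSum (h : LetterSystem a D T m o) (hρ : Metric.closedBall t₀ ρ ⊆ D)
    {f : List ι → ℝ → Metric.closedBall t₀ ρ → ℂ} {r : List ι → Metric.closedBall t₀ ρ → ℂ}
    (hf : ∀ u, FamLogExp (f u) (r u)) (v : ℂ → List ι →₀ ℚ) :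
    FamLogExp
      (fun x (p : Metric.closedBall t₀ ρ) => ∑ τ ∈ T, ((p : ℂ) - τ)⁻¹ *
        wordSum (v τ) fun u => f u x p)
      (fun p : Metric.closedBall t₀ ρ => ∑ τ ∈ T, ((p : ℂ) - τ)⁻¹ * wordSum (v τ) fun u => r u p) := by
  refine FamLogExp.sum T fun τ hτ => FamLogExp.const_mul ?_
    (restrictBall hρ (h.continuousOn_inv_sub hτ))
  exact FamLogExp.sum (v τ).support fun u _ =>
    (hf u).const_mul (ContinuousMap.const _ ((v τ u : ℚ) : ℂ))

theorem famCont_paramDeriv (h : LetterSystem a D T m o) (hρ : Metric.closedBall t₀ ρ ⊆ D)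
    (w : List ι) : FamCont (fun x (p : Metric.closedBall t₀ ρ) => paramDeriv a T m o w x p) := by
  have h1 : FamCont (fun x (p : Metric.closedBall t₀ ρ) => ∑ τ ∈ T, ((p : ℂ) - τ)⁻¹ *
      wordSum (wordDeriv (m τ) o w) (fun u => letterLog a u x p)) :=
    FamCont.sum T fun τ hτ =>
      (famCont_const (restrictBall hρ (h.continuousOn_inv_sub hτ))).mul
        (FamCont.sum _ fun u _ => (famCont_const (ContinuousMap.const _ _)).mul
          (h.fam_letterLog hρ u).2.1)
  have h2 : FamCont (fun x (p : Metric.closedBall t₀ ρ) => -1 * headTerm a w x p) := by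
    refine (famCont_const (ContinuousMap.const _ (-1 : ℂ))).mul ?_
    cases w with
    | nil => exact famCont_const 0
    | cons i w =>
      exact (famCont_const (restrictBall hρ (h.continuousOn_deriv i))).mul
        ((famCont_inv_sub (b := restrictBall hρ (h.differentiableOn i).continuousOn)
          (fun p => h.ne_pos i p (hρ p.2))).mul (h.fam_letterLog hρ w).2.1)
  have := h1.add h2
  simpa only [paramDeriv, sub_eq_add_neg, neg_one_mul] using this

/-- Only one-letter words could contribute at x = 0, since nonempty words regularize to 0. For [i]
the term -m τ i o [] of the derivation is cancelled by the boundary term, whose limit is -a_i'/a_i.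
This is why the last letter is compared with the letter 0. -/
theorem famLogExp_paramDeriv_zero (h : LetterSystem a D T m o)
    (hρ : Metric.closedBall t₀ ρ ⊆ D) (i : ι) (w : List ι) :
    FamLogExp (fun x (p : Metric.closedBall t₀ ρ) => paramDeriv a T m o (i :: w) x p)
      (fun _ => 0) := by
  have h1 := h.famLogExp_wordSum hρ (fun u => (h.fam_letterLog hρ u).1)
    (fun τ => wordDeriv (m τ) o (i :: w))
  have h2 : FamLogExp (fun x (p : Metric.closedBall t₀ ρ) => -headTerm a (i :: w) x p)
      (fun p => (∑ τ ∈ T, ((p : ℂ) - τ)⁻¹ * m τ i o) * emptyIndicator w) := by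
    -- For the letter 0 the kernel 1/x is singular, but its coefficient a_o' vanishes.
    by_cases hi : i = o
    · refine (famLogExp_const 0).congr (Eventually.of_forall fun x p => ?_) fun p => ?_
      · simp [headTerm, hi, h.deriv_zero (hρ p.2)]
      · simp [hi, h.self_eq_zero]
    · obtain ⟨K, hK, hK0, hKx⟩ := exists_analyticAt_inv_sub
        (b := restrictBall hρ (h.differentiableOn i).continuousOn) (by
          rw [ContinuousMap.isUnit_iff_forall_ne_zero]
          exact fun p => h.ne_zero i hi p (hρ p.2))
      have hKx' := tendsto_ofReal_nhdsGT_slitPlane.eventually (nhdsWithin_le_nhds hKx)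
      refine (((h.fam_letterLog hρ w).1.analytic_mul hK hKx').const_mul
        (-restrictBall hρ (h.continuousOn_deriv i))).congr
        (Eventually.of_forall fun x p => ?_) fun p => ?_
      · simp [headTerm, restrictBall]
      · have h0 := h.ne_zero i hi p (hρ p.2)
        rw [hK0]
        simp only [ContinuousMap.neg_apply, restrictBall, ContinuousMap.coe_mk]
        rw [h.deriv_eq i (hρ p.2)]
        field_simp
  refine (h1.add h2).congr (Eventually.of_forall fun x p => ?_) fun p => ?_
  · simp only [paramDeriv, sub_eq_add_neg]
  · cases w with
    | nil =>
      simp only [wordSum_wordDeriv_singleton]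
      simp [emptyIndicator]
    | cons j w =>
      simp only [wordSum_wordDeriv_cons_cons]
      simp [emptyIndicator, wordSum_zero_right]

/-- The boundary term carries a factor y = 1/x in front of an expansion, so its regularized value is
0 and only the sum over τ survives. -/
theorem famLogExp_paramDeriv_inv (h : LetterSystem a D T m o)
    (hρ : Metric.closedBall t₀ ρ ⊆ D) (w : List ι) :
    FamLogExp (fun y (p : Metric.closedBall t₀ ρ) => paramDeriv a T m o w y⁻¹ p)
      (fun p => ∑ τ ∈ T, ((p : ℂ) - τ)⁻¹ *
        wordSum (wordDeriv (m τ) o w) fun u => letterReg a u p) := by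
  have h1 := h.famLogExp_wordSum hρ (fun u => (h.fam_letterLog hρ u).2.2)
    (fun τ => wordDeriv (m τ) o w)
  have h2 : FamLogExp (fun y (p : Metric.closedBall t₀ ρ) => -headTerm a w y⁻¹ p)
      (fun p => 0) := by
    cases w with
    | nil =>
      exact (famLogExp_const 0).congr (Eventually.of_forall fun x p => by simp [headTerm])
        fun p => rfl
    | cons i w =>
      obtain ⟨K, hK, hKx⟩ := exists_analyticAt_inv_inv_sub
        (restrictBall hρ (h.differentiableOn i).continuousOn)
      have hKx' := tendsto_ofReal_nhdsGT_slitPlane.eventually (eventually_slitPlane_nhds hKx)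
      refine (((h.fam_letterLog hρ w).2.2.analytic_mul
        (K := fun y => y • K y) (k := fun (y : ℝ) (p : Metric.closedBall t₀ ρ) => ((y : ℂ)⁻¹ - a i p)⁻¹)
        (analyticAt_id.smul hK) (hKx'.mono fun y hy p => ?_)).const_mul
        (-restrictBall hρ (h.continuousOn_deriv i))).congr
        (Eventually.of_forall fun x p => ?_) fun p => ?_
      · simpa [restrictBall] using hy p
      · simp [headTerm, restrictBall]
      · simp
  refine (h1.add h2).congr (Eventually.of_forall fun x p => ?_) fun p => ?_
  · simp only [paramDeriv, sub_eq_add_neg]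
  · simp

theorem hasDerivAt_letterLog_param (h : LetterSystem a D T m o) (w : List ι) {x : ℝ} (hx : 0 < x)
    {t₀ : ℂ} (ht₀ : t₀ ∈ D) :
    HasDerivAt (letterLog a w x) (paramDeriv a T m o w x t₀) t₀ := by
  induction w generalizing x t₀ with
  | nil =>
    have : paramDeriv a T m o [] x t₀ = 0 := by
      simp [paramDeriv, headTerm, wordDeriv, wordSum_zero]
    rw [this]
    exact hasDerivAt_const t₀ (1 : ℂ)
  | cons i w ih =>
    obtain ⟨ρ, hρ0, hρ⟩ := Metric.nhds_basis_closedBall.mem_iff.1 (h.isOpen.mem_nhds ht₀)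
    set p₀ : Metric.closedBall t₀ ρ := ⟨t₀, Metric.mem_closedBall_self hρ0.le⟩
    set Q : ℝ → Metric.closedBall t₀ ρ → ℂ := fun x p =>
      ((x : ℂ) - a i p)⁻¹ * paramDeriv a T m o w x p +
        deriv (a i) p * (((x : ℂ) - a i p)⁻¹ * (((x : ℂ) - a i p)⁻¹ * letterLog a w x p)) with hQ
    have hκ : FamCont (fun (x : ℝ) (p : Metric.closedBall t₀ ρ) => ((x : ℂ) - a i p)⁻¹) :=
      famCont_inv_sub (b := restrictBall hρ (h.differentiableOn i).continuousOn)
        (fun p => h.ne_pos i p (hρ p.2))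
    have hQc : FamCont Q :=
      (hκ.mul (h.famCont_paramDeriv hρ w)).add
        ((famCont_const (restrictBall hρ (h.continuousOn_deriv i))).mul
          (hκ.mul (hκ.mul (h.fam_letterLog hρ w).2.1)))
    obtain ⟨N, N', hN, hNeq, hN'eq⟩ := hQc.exists_primitive
      (F := fun x (p : Metric.closedBall t₀ ρ) => paramDeriv a T m o (i :: w) x p)
      (fun x hx p => h.hasDerivAt_paramDeriv_cons i w (hρ p.2) hx) one_pos
      ((h.famCont_paramDeriv hρ (i :: w)).continuous one_pos)
    -- By the induction hypothesis, Q is the t-derivative of the integrand (x - a_i)⁻¹ L_w, while it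
    -- is also the x-derivative of `paramDeriv` for i :: w. This equality of mixed derivatives makes
    -- φ below independent of x.
    have hQder : ∀ x : ℝ, 0 < x → ∀ p : Metric.closedBall t₀ ρ,
        HasDerivAt (fun t => ((x : ℂ) - a i t)⁻¹ * letterLog a w x t) (Q x p) p := by
      intro x hx p
      have hp := hρ p.2
      have h1 := (((h.differentiableOn i).differentiableAt (h.isOpen.mem_nhds hp)).hasDerivAt
        ).const_sub (x : ℂ)
      have h2 := h.sub_ne_zero_of_pos i hp hx
      convert! (h1.fun_inv h2).mul (ih hx hp) using 1
      rw [hQ]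
      field_simp
      ring
    have hint : ∀ x : ℝ, 0 < x → ∀ t : Metric.closedBall t₀ ρ,
        letterLog a (i :: w) x t - letterLog a (i :: w) x t₀ =
          (t - t₀) * ∫ s in (0 : ℝ)..1, paramDeriv a T m o (i :: w) x (ballSegment t s) := by
      intro x hx t
      set φ : ℝ → ℂ := fun x => letterLog a (i :: w) x t - letterLog a (i :: w) x p₀ -
        (t - t₀) * ∫ s in (0 : ℝ)..1, paramDeriv a T m o (i :: w) x (ballSegment t s) with hφ
      have hφd : ∀ x, 0 < x → HasDerivAt φ 0 x := by
        intro x hx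
        have h1 := h.hasDerivAt_letterLog_cons i w (hρ t.2) hx
        have h2 := h.hasDerivAt_letterLog_cons i w (hρ p₀.2) hx
        have h3 := ((pathIntegralCLM (ballSegment t)).restrictScalars ℝ).hasFDerivAt.comp_hasDerivAt
          x (hN x hx)
        have h4 := (h1.sub h2).sub (h3.const_mul ((t : ℂ) - t₀))
        have h5 := sub_eq_mul_integral_ballSegment (hQc.continuous hx) (hQder x hx) t
        refine HasDerivAt.congr_of_eventuallyEq (f := fun x => letterLog a (i :: w) x t -
          letterLog a (i :: w) x p₀ - (t - t₀) * pathIntegralCLM (ballSegment t) (N x)) ?_ ?_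
        · convert! h4 using 1
          simp only [ContinuousLinearMap.coe_restrictScalars', pathIntegralCLM_apply, hN'eq x hx]
          rw [← h5, sub_self]
        · filter_upwards [Ioi_mem_nhds hx] with y hy
          simp only [hφ, pathIntegralCLM_apply, hNeq y hy]
      have hconst : ∀ y, 0 < y → φ y = φ x := fun y hy =>
        isOpen_Ioi.is_const_of_deriv_eq_zero isPreconnected_Ioi
          (fun z hz => (hφd z hz).differentiableAt.differentiableWithinAt)
          (fun z hz => (hφd z hz).deriv) hy hx
      -- The constant φ equals its own regularized limit at 0, and every term of φ regularizes to a
      -- quantity that cancels or vanishes.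
      have hreg := (h.fam_letterLog hρ (i :: w)).1.reg_integral
        (h.famLogExp_paramDeriv_zero hρ i w) (ballSegment t) t p₀ (t - t₀) (φ x) (by
          filter_upwards [self_mem_nhdsWithin] with y hy using hconst y hy)
      have : φ x = 0 := by
        rw [← hreg]
        simp
      exact sub_eq_zero.1 this
    exact hasDerivAt_of_eq_mul_integral_ballSegment hρ0
      ((h.famCont_paramDeriv hρ (i :: w)).continuous hx) (hint x hx)

theorem hasDerivAt_letterReg (h : LetterSystem a D T m o) (w : List ι) {t₀ : ℂ} (ht₀ : t₀ ∈ D) :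
    HasDerivAt (letterReg a w) (∑ τ ∈ T, (t₀ - τ)⁻¹ *
      wordSum (wordDeriv (m τ) o w) fun u => letterReg a u t₀) t₀ := by
  obtain ⟨ρ, hρ0, hρ⟩ := Metric.nhds_basis_closedBall.mem_iff.1 (h.isOpen.mem_nhds ht₀)
  have hn := h.famLogExp_paramDeriv_inv hρ w
  refine hasDerivAt_of_eq_mul_integral_ballSegment hρ0 hn.continuous_reg fun t => ?_
  have hreg := (h.fam_letterLog hρ w).2.2.reg_integral hn (ballSegment t) t
    ⟨t₀, Metric.mem_closedBall_self hρ0.le⟩ (t - t₀) 0 (by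
      filter_upwards [self_mem_nhdsWithin] with y hy
      have hy : 0 < y⁻¹ := inv_pos.2 hy
      exact sub_eq_zero.2 (sub_eq_mul_integral_ballSegment
        ((h.famCont_paramDeriv hρ w).continuous hy)
        (fun p => h.hasDerivAt_letterLog_param w hy (hρ p.2)) t))
  exact sub_eq_zero.1 hreg

end LetterSystem

end LetterSystem

/-! ### Regularized limits at t → 0 and combinations of hyperlogarithms. -/

section RegLimZero

/-- Close to 0 the set is a slit disc, star-shaped about a positive real point; every other point
reaches this disc along its own ray. -/
theorem isPreconnected_cutPlane {S : Set ℂ} (hS : S.Finite) : IsPreconnected (cutPlane S) := by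
  obtain ⟨r, hr, hball⟩ := Metric.nhdsWithin_basis_ball.eventually_iff.1 (eventually_mem_cutPlane hS)
  set B : Set ℂ := Complex.slitPlane ∩ Metric.ball 0 r with hB
  have hx₀ : ((r / 2 : ℝ) : ℂ) ∈ Metric.ball (0 : ℂ) r := by
    rw [mem_ball_zero_iff, Complex.norm_real, Real.norm_of_nonneg (by linarith)]
    linarith
  have hxB : ((r / 2 : ℝ) : ℂ) ∈ B := ⟨Complex.ofReal_mem_slitPlane.2 (by linarith), hx₀⟩
  have hBs : StarConvex ℝ ((r / 2 : ℝ) : ℂ) B :=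
    (Complex.starConvex_ofReal_slitPlane (half_pos hr)).inter ((convex_ball 0 r).starConvex hx₀)
  have hBc : IsPreconnected B := (hBs.isPathConnected hxB).isConnected.isPreconnected
  refine isPreconnected_of_forall ((r / 2 : ℝ) : ℂ) fun z hz => ?_
  obtain ⟨ε, hε, hε0, hε1⟩ := (((tendsto_real_mul_slitPlane hz.1).eventually
    (Metric.nhdsWithin_basis_ball.mem_of_mem hr)).and (Ioo_mem_nhdsGT one_pos)).exists
  refine ⟨B ∪ (fun s : ℝ => (s : ℂ) * z) '' Set.Icc ε 1, ?_, Or.inl hxB,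
    Or.inr ⟨1, ⟨hε1.le, le_rfl⟩, by simp⟩, ?_⟩
  · rintro _ (h | ⟨s, hs, rfl⟩)
    · exact hball ⟨h.2, h.1⟩
    · exact real_mul_mem_cutPlane hz (hε0.trans_le hs.1) hs.2
  · refine IsPreconnected.union ((ε : ℂ) * z) ⟨hε.2, hε.1⟩ ⟨ε, ⟨le_rfl, hε1.le⟩, rfl⟩ hBc ?_
    exact isPreconnected_Icc.image _
      (Complex.continuous_ofReal.mul continuous_const).continuousOn

theorem logExp_of_sum {n : ℕ} {g : ℕ → ℂ → ℂ} (hg : ∀ i, AnalyticAt ℂ (g i) 0) :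
    ∃ v, v 0 = g 0 0 ∧
      LogExp (fun z => ∑ i ∈ Finset.range (n + 1), g i z * Complex.log z ^ i) v := by
  refine ⟨_, ?_, (LogExp.sum (Finset.range (n + 1)) fun i _ => logExp_log_pow_smul (hg i) i).congr
    (Eventually.of_forall fun z => by simp [mul_comm])⟩
  simp [Finset.sum_apply, Pi.single_apply]

/-- Two continuations agree by the identity theorem on the connected cut plane, and the expansion of
one function on the positive axis has unique values. -/
theorem HasRegLimZero.unique {S V : Set ℂ} (hS : S.Finite) (hVo : IsOpen V) (hV : V.Nonempty)
    (hVU : V ⊆ cutPlane S) {f : ℂ → ℂ} {c c' : ℂ} (h : HasRegLimZero (cutPlane S) V f c)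
    (h' : HasRegLimZero (cutPlane S) V f c') : c = c' := by
  obtain ⟨F, hF, hFf, n, g, hg, rfl, hFg⟩ := h
  obtain ⟨F', hF', hFf', n', g', hg', rfl, hFg'⟩ := h'
  obtain ⟨t, ht⟩ := hV
  have hU := isOpen_cutPlane hS
  have hEq : Set.EqOn F F' (cutPlane S) := by
    refine (hF.analyticOnNhd hU).eqOn_of_preconnected_of_eventuallyEq (hF'.analyticOnNhd hU)
      (isPreconnected_cutPlane hS) (hVU ht) ?_
    filter_upwards [hVo.mem_nhds ht] with s hs
    rw [hFf hs, hFf' hs]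
  obtain ⟨v, hv, hL⟩ := logExp_of_sum (n := n) hg
  obtain ⟨v', hv', hL'⟩ := logExp_of_sum (n := n') hg'
  rw [← hv, ← hv']
  refine congrFun (hL.values_unique hL' ?_) 0
  have hpos : Tendsto (fun x : ℝ => (x : ℂ)) (𝓝[>] 0) (𝓝[cutPlane S] 0) :=
    tendsto_nhdsWithin_iff.2 ⟨tendsto_ofReal_nhdsGT_slitPlane.mono_right nhdsWithin_le_nhds,
      tendsto_ofReal_nhdsGT_slitPlane.eventually (eventually_mem_cutPlane hS)⟩
  filter_upwards [hpos.eventually hFg, hpos.eventually hFg',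
    hpos.eventually self_mem_nhdsWithin] with x h1 h2 h3
  rw [← h1, ← h2, hEq h3]

/-- A linear combination of hyperlogarithms. -/
noncomputable def hyperlogSum {S : Set ℂ} (c : List S →₀ ℂ) (t : ℂ) : ℂ :=
  c.sum fun u a => a * hyperlog (u.map Subtype.val) t

theorem mem_of_mem_map_val {α : Type*} {S : Set α} {u : List S} {x : α}
    (hx : x ∈ u.map Subtype.val) : x ∈ S := by
  obtain ⟨y, -, rfl⟩ := List.mem_map.1 hx
  exact y.2

theorem differentiableAt_hyperlogSum {S : Set ℂ} (hS : S.Finite) (c : List S →₀ ℂ) {t : ℂ}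
    (ht : t ∈ cutPlane S) : DifferentiableAt ℂ (hyperlogSum c) t :=
  DifferentiableAt.fun_sum fun _ _ => (differentiableAt_hyperlog hS (fun _ => mem_of_mem_map_val) ht).const_mul _

/-- The combination itself is the continuation. Nonempty words have regularized value 0 at the
origin, so only the coefficient of the empty word is left. -/
theorem hasRegLimZero_of_eqOn_hyperlogSum {S V : Set ℂ} (hS : S.Finite)
    {f : ℂ → ℂ} {c : List S →₀ ℂ} (h : ∀ t ∈ V, f t = hyperlogSum c t) :
    HasRegLimZero (cutPlane S) V f (c []) := by
  have hL : LogExp (hyperlogSum c) (∑ u ∈ c.support, c u • hyperlogValues (u.map Subtype.val)) :=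
    LogExp.sum c.support fun u _ => (logExp_hyperlog (u.map Subtype.val)).const_smul (c u)
  obtain ⟨n, g, h1, h2, h3, h4⟩ := hL
  refine ⟨hyperlogSum c, fun t ht => (differentiableAt_hyperlogSum hS c ht).differentiableWithinAt,
    fun t ht => (h t ht).symm, n, g, h1, ?_, ?_⟩
  · rw [h2, Finset.sum_apply, Finset.sum_eq_single []]
    · simp [hyperlogValues]
    · intro u _ hu
      rw [Pi.smul_apply, hyperlogValues_zero (List.map_eq_nil_iff.not.2 hu), smul_zero]
    · intro hu
      rw [Finsupp.notMem_support_iff.1 hu, zero_smul, Pi.zero_apply]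
  · filter_upwards [nhdsWithin_mono 0 (fun t ht => ht.1 : cutPlane S ⊆ Complex.slitPlane) h4]
      with t ht
    rw [ht, sum_range_eq_of_vanish n.le_succ _ fun i hi => by simp [h3 i hi]]
    exact Finset.sum_congr rfl fun i _ => by rw [smul_eq_mul, mul_comm]

theorem hasDerivAt_hyperlogSum_cons {S : Set ℂ} (hS : S.Finite) (τ : S) (c : List S →₀ ℂ) {t : ℂ}
    (ht : t ∈ cutPlane S) :
    HasDerivAt (hyperlogSum (c.mapDomain (List.cons τ))) ((t - τ)⁻¹ * hyperlogSum c t) t := by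
  have h1 : hyperlogSum (c.mapDomain (List.cons τ)) =
      fun t => c.sum fun u a => a * hyperlog ((τ : ℂ) :: u.map Subtype.val) t := by
    funext t
    exact Finsupp.sum_mapDomain_index (by simp) (by intros; ring)
  rw [h1, hyperlogSum, Finsupp.mul_sum]
  have h2 := HasDerivAt.fun_sum (u := c.support) fun u _ =>
    (hasDerivAt_hyperlog_cons hS τ.2 (w := u.map Subtype.val)
      (fun _ => mem_of_mem_map_val) ht).const_mul (c u)
  convert! h2 using 1
  exact Finset.sum_congr rfl fun u _ => by ring

theorem hyperlogSum_add {S : Set ℂ} (c c' : List S →₀ ℂ) (t : ℂ) :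
    hyperlogSum (c + c') t = hyperlogSum c t + hyperlogSum c' t :=
  Finsupp.sum_add_index' (by simp) (by intros; ring)

theorem hyperlogSum_sum {S : Set ℂ} {κ : Type*} (s : Finset κ) (c : κ → List S →₀ ℂ) (t : ℂ) :
    hyperlogSum (∑ k ∈ s, c k) t = ∑ k ∈ s, hyperlogSum (c k) t :=
  (Finsupp.sum_finsetSum_index (by simp) (by intros; ring)).symm

end RegLimZero

/-! ### Integrating the differential equation by induction on word length. -/

section Representation

variable {ι : Type*}

/-- The linear extension of `wordDeriv`. -/
noncomputable def wordDerivSum (m : ι → ι → ℚ) (o : ι) (w : List ι →₀ ℚ) : List ι →₀ ℚ :=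
  w.sum fun u q => q • wordDeriv m o u

theorem wordSum_wordDerivSum (m : ι → ι → ℚ) (o : ι) (w : List ι →₀ ℚ) (Λ : List ι → ℂ) :
    wordSum (wordDerivSum m o w) Λ = wordSum w fun u => wordSum (wordDeriv m o u) Λ := by
  classical
  have : ∀ s : Finset (List ι), wordSum (∑ u ∈ s, w u • wordDeriv m o u) Λ =
      ∑ u ∈ s, (w u : ℂ) * wordSum (wordDeriv m o u) Λ := by
    intro s
    induction s using Finset.induction_on with
    | empty => simp [wordSum_zero]
    | insert a s ha ih =>
      rw [Finset.sum_insert ha, Finset.sum_insert ha, wordSum_add, wordSum_smul, ih]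
  exact this _

theorem length_of_mem_support_wordDerivSum (m : ι → ι → ℚ) (o : ι) {w : List ι →₀ ℚ} {n : ℕ}
    (hw : ∀ u ∈ w.support, u.length < n + 1) :
    ∀ u ∈ (wordDerivSum m o w).support, u.length < n := by
  classical
  intro u hu
  obtain ⟨u', hu', hmem⟩ := Finsupp.mem_support_finsetSum u hu
  have h1 := length_of_mem_support_wordDeriv m o u' u (Finsupp.support_smul hmem)
  have h2 := hw u' hu'
  omega

theorem LetterSystem.exists_hyperlogSum {a : ι → ℂ → ℂ} {D S : Set ℂ} (hS : S.Finite)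
    {m : ℂ → ι → ι → ℚ} {o : ι} (h : LetterSystem a D hS.toFinset m o) (hDU : D ⊆ cutPlane S)
    {V : Set ℂ} (hVo : IsOpen V) (hVc : IsConnected V) (hVD : V ⊆ D) (n : ℕ) (w : List ι →₀ ℚ)
    (hw : ∀ u ∈ w.support, u.length < n) :
    ∃ c : List S →₀ ℂ,
      (∀ u, ∃ v : List ι →₀ ℚ, HasRegLimZero (cutPlane S) V
        (fun t => wordSum v fun u => letterReg a u t) (c u)) ∧
      ∀ t ∈ V, (wordSum w fun u => letterReg a u t) = hyperlogSum c t := by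
  classical
  induction n generalizing w with
  | zero =>
    have hw0 : w = 0 := by
      rw [← Finsupp.support_eq_empty]
      exact Finset.eq_empty_of_forall_notMem fun u hu => absurd (hw u hu) (Nat.not_lt_zero _)
    subst hw0
    have heq : ∀ t ∈ V, (wordSum (0 : List ι →₀ ℚ) fun u => letterReg a u t) =
        hyperlogSum (0 : List S →₀ ℂ) t := fun t _ => by simp [wordSum_zero, hyperlogSum]
    exact ⟨0, fun u => ⟨0, hasRegLimZero_of_eqOn_hyperlogSum hS heq⟩, heq⟩
  | succ n ih =>
    have := hS.fintype
    choose c hc hceq using fun τ : S => ih (wordDerivSum (m τ) o w)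
      (length_of_mem_support_wordDerivSum (m τ) o hw)
    -- Prepending τ integrates multiplication by (t - τ)⁻¹, so this is a primitive of the derivative
    -- given by the shorter words.
    set cs : List S →₀ ℂ := ∑ τ, (c τ).mapDomain (List.cons τ) with hcs
    obtain ⟨t₀, ht₀⟩ := hVc.nonempty
    have hder : ∀ t ∈ V, HasDerivAt
        (fun t => (wordSum w fun u => letterReg a u t) - hyperlogSum cs t) 0 t := by
      intro t ht
      have h1 : HasDerivAt (fun t => wordSum w fun u => letterReg a u t)
          (wordSum w fun u => ∑ τ ∈ hS.toFinset, (t - τ)⁻¹ *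
            wordSum (wordDeriv (m τ) o u) fun u => letterReg a u t) t :=
        HasDerivAt.fun_sum fun u _ => (h.hasDerivAt_letterReg u (hVD ht)).const_mul _
      have h2 : HasDerivAt (hyperlogSum cs) (∑ τ : S, (t - τ)⁻¹ * hyperlogSum (c τ) t) t := by
        have : hyperlogSum cs = fun t => ∑ τ : S,
            hyperlogSum ((c τ).mapDomain (List.cons τ)) t := by
          funext t
          rw [hcs, hyperlogSum_sum]
        rw [this]
        exact HasDerivAt.fun_sum fun τ _ => hasDerivAt_hyperlogSum_cons hS τ (c τ) (hDU (hVD ht))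
      have h3 := h1.sub h2
      convert! h3 using 1
      have h4 : (wordSum w fun u => ∑ τ ∈ hS.toFinset, (t - τ)⁻¹ *
          wordSum (wordDeriv (m τ) o u) fun u => letterReg a u t) =
          ∑ τ ∈ hS.toFinset, (t - τ)⁻¹ *
            wordSum (wordDerivSum (m τ) o w) fun u => letterReg a u t := by
        simp only [wordSum_wordDerivSum]
        simp only [← wordSum_mul_left]
        simp only [wordSum, Finsupp.sum, Finset.mul_sum]
        rw [Finset.sum_comm]
      rw [h4, Finset.sum_subtype hS.toFinset (p := fun τ => τ ∈ S) (by simp), eq_comm, sub_eq_zero]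
      exact Finset.sum_congr rfl fun τ _ => by rw [hceq τ t ht]
    set C : ℂ := (wordSum w fun u => letterReg a u t₀) - hyperlogSum cs t₀ with hC
    have heq : ∀ t ∈ V, (wordSum w fun u => letterReg a u t) =
        hyperlogSum (Finsupp.single [] C + cs) t := by
      intro t ht
      have h1 : (wordSum w fun u => letterReg a u t) - hyperlogSum cs t = C :=
        hVo.is_const_of_deriv_eq_zero hVc.isPreconnected
          (fun t ht => (hder t ht).differentiableAt.differentiableWithinAt)
          (fun t ht => (hder t ht).deriv) ht ht₀
      have h2 : hyperlogSum (Finsupp.single ([] : List S) C) t = C := by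
        rw [hyperlogSum, Finsupp.sum_single_index (by simp)]
        simp [hyperlog]
      rw [hyperlogSum_add, h2, ← h1]
      ring
    refine ⟨Finsupp.single [] C + cs, fun u => ?_, heq⟩
    cases u with
    -- The constant of integration is the regularized value of the function being represented, so w
    -- itself is the witness.
    | nil => exact ⟨w, hasRegLimZero_of_eqOn_hyperlogSum hS heq⟩
    | cons τ u =>
      have : (Finsupp.single ([] : List S) C + cs) (τ :: u) = c τ u := by
        rw [Finsupp.add_apply, Finsupp.single_eq_of_ne (by simp), zero_add, hcs,
          Finsupp.finsetSum_apply, Finset.sum_eq_single τ]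
        · exact Finsupp.mapDomain_apply (List.cons_injective) _ _
        · intro τ' _ hτ'
          refine Finsupp.mapDomain_of_notMem_range _ _ ?_
          rintro ⟨u', hu'⟩
          exact hτ' (List.cons_eq_cons.1 hu').1
        · simp
      rw [this]
      exact hc τ u

end Representation

/-! ### Rational functions over ℚ form a letter system. -/

section RationalLetters

variable {A : Finset (RatFunc ℚ)}

theorem finite_zeroPoleSet (A : Finset (RatFunc ℚ)) : (zeroPoleSet A).Finite := by
  have : zeroPoleSet A ⊆ ⋃ σ ∈ A, ⋃ ρ ∈ A,
      ((σ - ρ).num.rootSet ℂ ∪ (σ - ρ).denom.rootSet ℂ) := by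
    rintro τ ⟨σ, hσ, ρ, hρ, hne, h⟩
    simp only [Set.mem_iUnion]
    refine ⟨σ, hσ, ρ, hρ, ?_⟩
    rcases h with h | h
    · exact Or.inl (Polynomial.mem_rootSet.2 ⟨RatFunc.num_ne_zero (sub_ne_zero.2 hne), h⟩)
    · exact Or.inr (Polynomial.mem_rootSet.2 ⟨RatFunc.denom_ne_zero _, h⟩)
  refine Set.Finite.subset ?_ this
  exact A.finite_toSet.biUnion fun σ _ => A.finite_toSet.biUnion fun ρ _ =>
    (Polynomial.rootSet_finite _ _).union (Polynomial.rootSet_finite _ _)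

theorem isAlgebraic_of_mem_zeroPoleSet {τ : ℂ} (h : τ ∈ zeroPoleSet A) : IsAlgebraic ℚ τ := by
  obtain ⟨σ, -, ρ, -, hne, h | h⟩ := h
  · exact ⟨_, RatFunc.num_ne_zero (sub_ne_zero.2 hne), h⟩
  · exact ⟨_, RatFunc.denom_ne_zero _, h⟩

theorem letterAt_eq (r : RatFunc ℚ) (t : ℂ) :
    letterAt r t = Polynomial.aeval t r.num / Polynomial.aeval t r.denom := rfl

theorem differentiableAt_letterAt {r : RatFunc ℚ} {t : ℂ}
    (h : Polynomial.aeval t r.denom ≠ 0) : DifferentiableAt ℂ (letterAt r) t :=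
  (Polynomial.differentiable_aeval _ t).div (Polynomial.differentiable_aeval _ t) h

theorem aeval_sub_ne_zero {σ ρ : RatFunc ℚ} (hσ : σ ∈ A) (hρ : ρ ∈ A) (hne : σ ≠ ρ) {t : ℂ}
    (ht : t ∈ cutPlane (zeroPoleSet A)) :
    Polynomial.aeval t (σ - ρ).num ≠ 0 ∧ Polynomial.aeval t (σ - ρ).denom ≠ 0 :=
  ⟨fun h => ne_of_mem_cutPlane ht ⟨σ, hσ, ρ, hρ, hne, Or.inl h⟩ rfl,
    fun h => ne_of_mem_cutPlane ht ⟨σ, hσ, ρ, hρ, hne, Or.inr h⟩ rfl⟩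

theorem aeval_denom_ne_zero (h0 : (0 : RatFunc ℚ) ∈ A) {σ : RatFunc ℚ} (hσ : σ ∈ A) {t : ℂ}
    (ht : t ∈ cutPlane (zeroPoleSet A)) : Polynomial.aeval t σ.denom ≠ 0 := by
  by_cases h : σ = 0
  · simp [h]
  · simpa using (aeval_sub_ne_zero hσ h0 h ht).2

theorem letterAt_ne_zero (h0 : (0 : RatFunc ℚ) ∈ A) {σ : RatFunc ℚ} (hσ : σ ∈ A) (h : σ ≠ 0)
    {t : ℂ} (ht : t ∈ cutPlane (zeroPoleSet A)) : letterAt σ t ≠ 0 := by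
  have := aeval_sub_ne_zero hσ h0 h ht
  rw [sub_zero] at this
  exact div_ne_zero this.1 this.2

theorem letterAt_zero (t : ℂ) : letterAt 0 t = 0 := RatFunc.eval_zero _ _

theorem letterAt_sub (h0 : (0 : RatFunc ℚ) ∈ A) {σ ρ : RatFunc ℚ} (hσ : σ ∈ A) (hρ : ρ ∈ A)
    {t : ℂ} (ht : t ∈ cutPlane (zeroPoleSet A)) :
    letterAt (σ - ρ) t = letterAt σ t - letterAt ρ t := by
  by_cases hne : σ = ρ
  · rw [hne, sub_self, sub_self, letterAt_zero]
  · have := RatFunc.eval_add (f := algebraMap ℚ ℂ) (a := t) (x := σ - ρ) (y := ρ)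
      (aeval_sub_ne_zero hσ hρ hne ht).2 (aeval_denom_ne_zero h0 hρ ht)
    rw [sub_add_cancel] at this
    exact eq_sub_of_add_eq this.symm

/-- The order of a rational function at `τ`. -/
noncomputable def orderAt (r : RatFunc ℚ) (τ : ℂ) : ℚ :=
  ((r.num.map (algebraMap ℚ ℂ)).rootMultiplicity τ : ℚ) -
    (r.denom.map (algebraMap ℚ ℂ)).rootMultiplicity τ

/-- The logarithmic derivative of a polynomial that splits over ℂ. Enlarging the root set to T adds
only terms of multiplicity 0, which allows one common T for all differences of letters. -/
theorem aeval_derivative_eq_sum {p : Polynomial ℚ} {t : ℂ} (ht : Polynomial.aeval t p ≠ 0)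
    {T : Finset ℂ} (hT : ∀ τ, Polynomial.aeval τ p = 0 → τ ∈ T) :
    Polynomial.aeval t (Polynomial.derivative p) = Polynomial.aeval t p *
      ∑ τ ∈ T, (t - τ)⁻¹ * ((p.map (algebraMap ℚ ℂ)).rootMultiplicity τ : ℂ) := by
  classical
  have h1 := (IsAlgClosed.splits (p.map (algebraMap ℚ ℂ))).eval_derivative_eq_eval_mul_sum
    (x := t) (by rwa [Polynomial.eval_map_algebraMap])
  rw [Polynomial.derivative_map, Polynomial.eval_map_algebraMap, Polynomial.eval_map_algebraMap,
    Finset.sum_multiset_map_count] at h1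
  rw [h1]
  congr 1
  simp only [Polynomial.count_roots, nsmul_eq_mul, one_div]
  rw [Finset.sum_subset (s₂ := T)]
  · exact Finset.sum_congr rfl fun _ _ => mul_comm _ _
  · intro τ hτ
    have := (Polynomial.mem_roots'.1 (Multiset.mem_toFinset.1 hτ)).2
    rw [Polynomial.IsRoot, Polynomial.eval_map_algebraMap] at this
    exact hT τ this
  · intro τ _ hτ
    rw [Multiset.mem_toFinset, ← Multiset.count_eq_zero, Polynomial.count_roots] at hτ
    simp [hτ]

theorem deriv_letterAt {r : RatFunc ℚ} {t : ℂ} (hn : Polynomial.aeval t r.num ≠ 0)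
    (hd : Polynomial.aeval t r.denom ≠ 0) {T : Finset ℂ}
    (hTn : ∀ τ, Polynomial.aeval τ r.num = 0 → τ ∈ T)
    (hTd : ∀ τ, Polynomial.aeval τ r.denom = 0 → τ ∈ T) :
    deriv (letterAt r) t = (∑ τ ∈ T, (t - τ)⁻¹ * (orderAt r τ : ℂ)) * letterAt r t := by
  have h1 := (Polynomial.hasDerivAt_aeval r.num t).fun_div
    (Polynomial.hasDerivAt_aeval r.denom t) hd
  rw [aeval_derivative_eq_sum hn hTn, aeval_derivative_eq_sum hd hTd] at h1
  have h2 : ∑ τ ∈ T, (t - τ)⁻¹ * (orderAt r τ : ℂ) =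
      ∑ τ ∈ T, (t - τ)⁻¹ * ((r.num.map (algebraMap ℚ ℂ)).rootMultiplicity τ : ℂ) -
      ∑ τ ∈ T, (t - τ)⁻¹ * ((r.denom.map (algebraMap ℚ ℂ)).rootMultiplicity τ : ℂ) := by
    rw [← Finset.sum_sub_distrib]
    refine Finset.sum_congr rfl fun τ _ => ?_
    rw [orderAt]
    push_cast
    ring
  rw [h2, letterAt_eq]
  refine h1.deriv.trans ?_
  field_simp

theorem letterSystem (h0 : (0 : RatFunc ℚ) ∈ A) (hopen : IsOpen (paramDomain A)) :
    LetterSystem (fun (i : A) t => letterAt i t) (paramDomain A)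
      (finite_zeroPoleSet A).toFinset (fun τ i j => orderAt (i.1 - j.1) τ) ⟨0, h0⟩ where
  isOpen := hopen
  differentiableOn i t ht :=
    (differentiableAt_letterAt (aeval_denom_ne_zero h0 i.2 ht.1)).differentiableWithinAt
  ne_pos i t ht x hx := ht.2 i.1 i.2 x hx
  eq_zero t _ := letterAt_zero t
  ne_zero i hi t ht := letterAt_ne_zero h0 i.2 (fun h => hi (Subtype.ext h)) ht.1
  notMem τ hτ ht := ne_of_mem_cutPlane ht.1 ((Set.Finite.mem_toFinset _).1 hτ) rfl
  self_eq_zero τ i := by simp [orderAt]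
  deriv_sub i j t ht := by
    have hi := differentiableAt_letterAt (aeval_denom_ne_zero h0 i.2 ht.1)
    have hj := differentiableAt_letterAt (aeval_denom_ne_zero h0 j.2 ht.1)
    by_cases hij : i = j
    · simp [hij]
    have hne : i.1 ≠ j.1 := fun h => hij (Subtype.ext h)
    have hev : (fun t => letterAt i.1 t - letterAt j.1 t) =ᶠ[𝓝 t] letterAt (i.1 - j.1) := by
      filter_upwards [(isOpen_cutPlane (finite_zeroPoleSet A)).mem_nhds ht.1] with s hs
      rw [letterAt_sub h0 i.2 j.2 hs]
    rw [← deriv_fun_sub hi hj, hev.deriv_eq, ← letterAt_sub h0 i.2 j.2 ht.1]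
    have hnd := aeval_sub_ne_zero i.2 j.2 hne ht.1
    exact deriv_letterAt hnd.1 hnd.2
      (fun τ hτ => (Set.Finite.mem_toFinset _).2 ⟨i.1, i.2, j.1, j.2, hne, Or.inl hτ⟩)
      (fun τ hτ => (Set.Finite.mem_toFinset _).2 ⟨i.1, i.2, j.1, j.2, hne, Or.inr hτ⟩)

end RationalLetters

/-! ### Openness and density of the parameter domain. -/

section Density

theorem neg_mem_slitPlane_iff {z : ℂ} :
    -z ∈ Complex.slitPlane ↔ z ≠ 0 ∧ ∀ x : ℝ, 0 < x → z ≠ x := by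
  rw [Complex.mem_slitPlane_iff]
  constructor
  · rintro h
    refine ⟨?_, ?_⟩
    · rintro rfl
      simp at h
    · rintro x hx rfl
      simp at h
      linarith
  · rintro ⟨h1, h2⟩
    by_contra! h
    have him : z.im = 0 := by simpa using h.2
    have hre : 0 ≤ z.re := by simpa using h.1
    have hz : z = (z.re : ℂ) := by
      apply Complex.ext <;> simp [him]
    rcases hre.eq_or_lt with h3 | h3
    · exact h1 (by rw [hz, ← h3]; simp)
    · exact h2 _ h3 hz

theorem dense_slitPlane : Dense Complex.slitPlane := by
  have h : Dense ({0}ᶜ : Set ℝ) := dense_compl_singleton 0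
  intro z
  rw [mem_closure_iff_frequently]
  have h1 : ∃ᶠ y : ℝ in 𝓝 z.im, y ≠ 0 := mem_closure_iff_frequently.1 (h z.im)
  have h2 : Tendsto (fun y : ℝ => (⟨z.re, y⟩ : ℂ)) (𝓝 z.im) (𝓝 z) := by
    have : Continuous fun y : ℝ => (z.re : ℂ) + y * Complex.I := by fun_prop
    have h3 := this.tendsto z.im
    rw [Complex.re_add_im] at h3
    convert! h3 using 2 with y
    apply Complex.ext <;> simp
  exact h2.frequently (h1.mono fun y hy => Complex.mem_slitPlane_iff.2 (Or.inr hy))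

/-- For τ ≠ 0, multiplication by -τ⁻¹ sends the ray into the negative axis, which reduces the claim
to the slit plane. -/
theorem dense_compl_ray (τ : ℂ) : Dense ((fun r : ℝ => r • τ) '' Set.Ici 1)ᶜ := by
  by_cases h : τ = 0
  · refine dense_slitPlane.mono fun z hz => ?_
    rintro ⟨r, -, rfl⟩
    simp [h] at hz
  · have h1 : -τ⁻¹ ≠ 0 := neg_ne_zero.2 (inv_ne_zero h)
    refine (dense_slitPlane.preimage (Homeomorph.mulLeft₀ (-τ⁻¹) h1).isOpenMap).mono fun z hz => ?_
    rintro ⟨r, hr, rfl⟩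
    have hr : (1 : ℝ) ≤ r := hr
    have h4 : -(r : ℂ) ∈ Complex.slitPlane := by
      have e : -τ⁻¹ * r • τ = -(r : ℂ) := by
        rw [Complex.real_smul]
        field_simp
      rw [← e]
      exact hz
    exact (neg_mem_slitPlane_iff.1 h4).2 r (by linarith) rfl

theorem dense_cutPlane {S : Set ℂ} (hS : S.Finite) : Dense (cutPlane S) := by
  have h1 : Dense (⋂ τ ∈ S, ((fun r : ℝ => r • τ) '' Set.Ici 1)ᶜ) :=
    dense_biInter_of_isOpen (fun τ _ => (isClosedMap_smul_left τ _ isClosed_Ici).isOpen_compl)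
      hS.countable fun τ _ => dense_compl_ray τ
  refine (dense_slitPlane.inter_of_isOpen_left h1 Complex.isOpen_slitPlane).mono ?_
  rintro z ⟨hz, hz'⟩
  refine ⟨hz, fun τ hτ r hr h => ?_⟩
  simp only [Set.mem_iInter] at hz'
  exact hz' τ hτ ⟨r, hr, by simp [h]⟩

theorem eq_C_of_eventually_letterAt_eq {r : RatFunc ℚ} {t c : ℂ}
    (hd : Polynomial.aeval t r.denom ≠ 0) (h : ∀ᶠ s in 𝓝 t, letterAt r s = c) :
    ∃ q : ℚ, r = RatFunc.C q ∧ (q : ℂ) = c := by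
  have hd' : ∀ᶠ s in 𝓝 t, Polynomial.aeval s r.denom ≠ 0 :=
    (Polynomial.differentiable_aeval r.denom t).continuousAt.eventually_ne hd
  have hp : r.num.map (algebraMap ℚ ℂ) = Polynomial.C c * r.denom.map (algebraMap ℚ ℂ) := by
    refine Polynomial.eq_of_infinite_eval_eq _ _ (Set.Infinite.mono (s := {s | letterAt r s = c ∧
      Polynomial.aeval s r.denom ≠ 0}) ?_ (infinite_of_mem_nhds t (h.and hd')))
    rintro s ⟨hs, hs'⟩
    rw [letterAt_eq, div_eq_iff hs'] at hs
    simpa [Polynomial.eval_map_algebraMap] using hs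
  -- Since the denominator is monic, comparing coefficients at its degree in num = c · denom
  -- exhibits c as a rational number.
  have hc : c = (r.num.coeff r.denom.natDegree : ℚ) := by
    have := congrArg (fun p => Polynomial.coeff p r.denom.natDegree) hp
    simp only [Polynomial.coeff_map, Polynomial.coeff_C_mul] at this
    rw [Polynomial.coeff_natDegree, (RatFunc.monic_denom r).leadingCoeff, map_one, mul_one] at this
    rw [← this]
    simp
  refine ⟨_, ?_, hc.symm⟩
  set q := r.num.coeff r.denom.natDegree
  have hnum : r.num = Polynomial.C q * r.denom := by
    apply Polynomial.map_injective (algebraMap ℚ ℂ) (algebraMap ℚ ℂ).injective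
    rw [hp, hc, Polynomial.map_mul, Polynomial.map_C]
    simp
  rw [← RatFunc.num_div_denom r, hnum, map_mul, mul_div_assoc, div_self, mul_one]
  · exact RatFunc.algebraMap_C q
  · exact RatFunc.algebraMap_ne_zero (RatFunc.denom_ne_zero r)

/-- The part of the cut plane where the letter `σ` takes no value in `(0, ∞)`. -/
def letterDomain (A : Finset (RatFunc ℚ)) (σ : RatFunc ℚ) : Set ℂ :=
  {t | t ∈ cutPlane (zeroPoleSet A) ∧ ∀ x : ℝ, 0 < x → letterAt σ t ≠ x}

variable {A : Finset (RatFunc ℚ)}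

theorem letterDomain_zero : letterDomain A 0 = cutPlane (zeroPoleSet A) := by
  ext t
  refine and_iff_left fun x hx h => ?_
  rw [letterAt_zero] at h
  exact hx.ne (by exact_mod_cast h)

/-- A nonzero letter has no zero in the cut plane, so avoiding (0, ∞) amounts to avoiding the closed
set [0, ∞). -/
theorem isOpen_letterDomain (h0 : (0 : RatFunc ℚ) ∈ A) {σ : RatFunc ℚ} (hσ : σ ∈ A) :
    IsOpen (letterDomain A σ) := by
  have hU := isOpen_cutPlane (finite_zeroPoleSet A)
  by_cases h : σ = 0
  · rw [h, letterDomain_zero]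
    exact hU
  · rw [isOpen_iff_mem_nhds]
    rintro t ⟨ht, htx⟩
    have h1 : -letterAt σ t ∈ Complex.slitPlane :=
      neg_mem_slitPlane_iff.2 ⟨letterAt_ne_zero h0 hσ h ht, htx⟩
    have h2 : ContinuousAt (fun t => -letterAt σ t) t :=
      (differentiableAt_letterAt (aeval_denom_ne_zero h0 hσ ht)).continuousAt.neg
    filter_upwards [hU.mem_nhds ht,
      h2.preimage_mem_nhds (Complex.isOpen_slitPlane.mem_nhds h1)] with s hs hs'
    exact ⟨hs, (neg_mem_slitPlane_iff.1 hs').2⟩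

/-- If the letter took only positive values near a point of the cut plane, the open mapping theorem
would make it constant there. It would then be a positive rational constant, which the alphabet
excludes. -/
theorem dense_letterDomain (h0 : (0 : RatFunc ℚ) ∈ A)
    (hpos : ∀ q : ℚ, 0 < q → RatFunc.C q ∉ A) {σ : RatFunc ℚ} (hσ : σ ∈ A) :
    Dense (letterDomain A σ) := by
  have hU := isOpen_cutPlane (finite_zeroPoleSet A)
  have hUd := dense_cutPlane (finite_zeroPoleSet A)
  refine Dense.of_closure (hUd.mono fun t ht => ?_)
  rw [mem_closure_iff_frequently]
  intro hnot
  have hval : ∀ᶠ s in 𝓝 t, ∃ x : ℝ, 0 < x ∧ letterAt σ s = x := by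
    filter_upwards [hnot, hU.mem_nhds ht] with s hs hs'
    by_contra! hx
    exact hs ⟨hs', hx⟩
  have hd : DifferentiableOn ℂ (letterAt σ) (cutPlane (zeroPoleSet A)) := fun s hs =>
    (differentiableAt_letterAt (aeval_denom_ne_zero h0 hσ hs)).differentiableWithinAt
  rcases (hd.analyticAt (hU.mem_nhds ht)).eventually_constant_or_nhds_le_map_nhds with hc | hc
  · obtain ⟨q, rfl, hq⟩ := eq_C_of_eventually_letterAt_eq (aeval_denom_ne_zero h0 hσ ht) hc
    obtain ⟨x, hx, hxe⟩ := hval.self_of_nhds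
    have hqx : (q : ℝ) = x := by
      rw [hxe] at hq
      exact_mod_cast hq
    exact hpos q (by exact_mod_cast hqx ▸ hx) hσ
  · have h1 : ∀ᶠ z : ℂ in 𝓝 (letterAt σ t), ∃ x : ℝ, 0 < x ∧ z = x := hc hval
    have h2 : ∃ᶠ z in 𝓝 (-letterAt σ t), z ∈ Complex.slitPlane :=
      mem_closure_iff_frequently.1 (dense_slitPlane _)
    have h3 := (continuous_neg.tendsto (-letterAt σ t)).frequently
      (p := fun z => -z ∈ Complex.slitPlane) (h2.mono fun z hz =>
      (by simpa using hz : - -z ∈ Complex.slitPlane))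
    rw [neg_neg] at h3
    obtain ⟨z, hz, x, hx, hzx⟩ := (h3.and_eventually h1).exists
    exact (neg_mem_slitPlane_iff.1 hz).2 x hx hzx

theorem paramDomain_eq (h0 : (0 : RatFunc ℚ) ∈ A) :
    paramDomain A = ⋂ σ ∈ A, letterDomain A σ := by
  ext t
  simp only [Set.mem_iInter]
  exact ⟨fun h σ hσ => ⟨h.1, h.2 σ hσ⟩, fun h => ⟨(h 0 h0).1, fun σ hσ => (h σ hσ).2⟩⟩

theorem isOpen_paramDomain (h0 : (0 : RatFunc ℚ) ∈ A) : IsOpen (paramDomain A) := by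
  rw [paramDomain_eq h0]
  exact isOpen_biInter_finset fun σ hσ => isOpen_letterDomain h0 hσ

theorem dense_paramDomain (h0 : (0 : RatFunc ℚ) ∈ A)
    (hpos : ∀ q : ℚ, 0 < q → RatFunc.C q ∉ A) : Dense (paramDomain A) := by
  rw [paramDomain_eq h0]
  exact dense_biInter_of_isOpen (S := (A : Set (RatFunc ℚ)))
    (fun σ hσ => isOpen_letterDomain h0 hσ) A.countable_toSet
    fun σ hσ => dense_letterDomain h0 hpos hσ

end Density

/-! ### Passage from the abstract letters to the functions R_w. -/

section Regularization

variable {A : Finset (RatFunc ℚ)}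

theorem hasRegLimInf_hyperlogAt (h0 : (0 : RatFunc ℚ) ∈ A) (w : WordSpace A) {t : ℂ}
    (ht : t ∈ paramDomain A) :
    HasRegLimInf (hyperlogAt w t)
      (wordSum w fun u => letterReg (fun (i : A) t => letterAt i t) u t) :=
  hasRegLimInf_wordSum (fun u => (letterSystem h0 (isOpen_paramDomain h0)).hasRegLimInf u ht) w

theorem regHyperlog_eq (h0 : (0 : RatFunc ℚ) ∈ A) (w : WordSpace A) {t : ℂ}
    (ht : t ∈ paramDomain A) :
    regHyperlog w t = wordSum w fun u => letterReg (fun (i : A) t => letterAt i t) u t :=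
  (hasRegLimInf_hyperlogAt h0 w ht).regLimInf_eq

theorem HasRegLimZero.congr {U V : Set ℂ} {f f' : ℂ → ℂ} {c : ℂ} (h : HasRegLimZero U V f c)
    (hf : Set.EqOn f f' V) : HasRegLimZero U V f' c := by
  obtain ⟨F, hF, hFf, h⟩ := h
  exact ⟨F, hF, hFf.trans hf, h⟩

end Regularization

theorem mainTheorem5 (A : Finset (RatFunc ℚ)) (h0 : (0 : RatFunc ℚ) ∈ A)
    (hpos : ∀ q : ℚ, 0 < q → RatFunc.C q ∉ A) :
    (zeroPoleSet A).Finite ∧ (∀ τ ∈ zeroPoleSet A, IsAlgebraic ℚ τ) ∧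
    IsOpen (paramDomain A) ∧ Dense (paramDomain A) ∧
    (∀ w : WordSpace A, ∀ t ∈ paramDomain A, ∃! c : ℂ, HasRegLimInf (hyperlogAt w t) c) ∧
    ∀ V : Set ℂ, IsOpen V → IsConnected V → V ⊆ paramDomain A →
      ∀ w : WordSpace A,
        (∃! c : ℂ, HasRegLimZero (cutPlane (zeroPoleSet A)) V (regHyperlog w) c) ∧
        ∃ c : List (zeroPoleSet A) →₀ ℂ,
          (∀ u, ∃ v : WordSpace A,
            HasRegLimZero (cutPlane (zeroPoleSet A)) V (regHyperlog v) (c u)) ∧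
          ∀ t ∈ V, regHyperlog w t =
            c.sum fun u a => a * hyperlog (u.map Subtype.val) t := by
  have hS := finite_zeroPoleSet A
  refine ⟨hS, fun τ hτ => isAlgebraic_of_mem_zeroPoleSet hτ, isOpen_paramDomain h0,
    dense_paramDomain h0 hpos, fun w t ht => ⟨_, hasRegLimInf_hyperlogAt h0 w ht,
      fun c hc => hc.unique (hasRegLimInf_hyperlogAt h0 w ht)⟩, fun V hVo hVc hVD w => ?_⟩
  have hDU : paramDomain A ⊆ cutPlane (zeroPoleSet A) := fun t ht => ht.1
  obtain ⟨c, hc, hceq⟩ := (letterSystem h0 (isOpen_paramDomain h0)).exists_hyperlogSum hS hDU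
    -- The induction uses a strict length bound, hence the successor of the maximal length.
    hVo hVc hVD (w.support.sup List.length + 1) w
    (fun u hu => Nat.lt_succ_of_le (Finset.le_sup (f := List.length) hu))
  have hR : ∀ t ∈ V, regHyperlog w t = hyperlogSum c t := fun t ht => by
    rw [regHyperlog_eq h0 w (hVD ht), hceq t ht]
  refine ⟨⟨c [], hasRegLimZero_of_eqOn_hyperlogSum hS hR, fun c' hc' =>
    hc'.unique hS hVo hVc.nonempty (hVD.trans hDU) (hasRegLimZero_of_eqOn_hyperlogSum hS hR)⟩,
    c, fun u => ?_, hR⟩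
  obtain ⟨v, hv⟩ := hc u
  exact ⟨v, hv.congr fun t ht => (regHyperlog_eq h0 v (hVD ht)).symm⟩
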